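/- **Setup.** A chain of $g$ loops is the metric graph $\Gamma$ with vertices $w_0,\dots,w_g$ and $v_1,\dots,v_{g+1}$, with a bridge $\beta_k$ of length $n_k>0$ from $w_k$ to $v_{k+1}$ for $0\le k\le g$, and with two edges (the top and the bottom edge of the $k$-th loop), of lengths $\ell_k>0$ and $m_k>0$, from $v_k$ to $w_k$ for $1\le k\le g$. For integers $r\ge 0$ and $s\ge 1$ with $(r+1)s\le g$ and a real number $C>0$, write $a\ll_C b$ for $Ca<b$. The edge lengths are *admissible* (for $r,s,C$) if - $4g\,m_k<\ell_k\ll_C\min\{n_{k-1},n_k\}$ for $1\le k\le g$; - there is no nontrivial relation $c_1m_1+\dots+c_gm_g=0$ with integers $|c_k|\le g+1$; - $\sum_{i=\alpha s+1}^{(\alpha+1)s}\ell_i+\sum_{i=\alpha s+1}^{(\alpha+1)s-1}n_i\ll_C\min\{n_{\alpha s},n_{(\alpha+1)s}\}$ for every integer $0\le\alpha\le r$. For a continuous piecewise linear function $\psi$ with integer slopes on $\Gamma$, $\operatorname{div}\psi$ is the divisor whose coefficient at a point is the sum of the incoming slopes of $\psi$ there. Divisors $D,D'$ are equivalent, $D\sim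 D'$, if $D'=D+\operatorname{div}\psi$ for some such $\psi$; rank means the Baker–Norine rank. The class of a divisor $D$ of rank $r$ is *vertex avoiding* if for every $0\le i\le r$ there is a unique divisor $D_i\sim D$ of the form $D_i=iw_0+(r-i)v_{g+1}+E_i$ with $E_i$ effective, and the support of $E_i$ contains none of the vertices $w_0,\dots,w_g,v_1,\dots,v_{g+1}$. For a multiset $I$ of size $m$ in $\{0,\dots,r\}$ let $\psi_I$ be a continuous piecewise linear function with integer slopes such that $mD+\operatorname{div}\psi_I=\sum_{i\in I}D_i$; it is determined up to an additive constant. A family of functions $(\psi_I)_{I\in\mathcal A}$ on $\Gamma$ is *tropically dependent* if there are real constants $b_I$ such that at every point $x\in\Gamma$ the minimum of the numbers $\psi_I(x)+b_I$ is attained for at least two indices $I\in\mathcal A$; otherwise it is *tropically independent*. The *tropical maximal rank conjecture for $(g,r,d,m)$* is the following assertion, where $s=g-d+r$: there is a constant $C>0$, depending only on $g,r,d,m$, such that on every chain of $g$ loops whose edge lengths are admissible for $r,s,C$ there are a divisor $D$ of rank $r$ and degree $d$ whose class is vertex avoiding, and a set $\mathcal A$ of multisets of size $m$ in $\{0,\dots,r\}$,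 with $$|\mathcal A|=\min\left\{\binom{r+m}{m},\ md-g+1\right\},$$ such that $(\psi_I)_{I\in\mathcal A}$ is tropically independent. **Theorem 1.5.** Let $g\ge 3$, $r=g-1$ and $d=2g-2$ (so $s=1$). Then for every integer $m\ge 1$ the tropical maximal rank conjecture holds for $(g,r,d,m)$. -/

import Mathlib

noncomputable section

/-- A (compact) metric graph, presented by a finite multigraph with positive edge lengths.
Each edge `e` carries the orientation from `src e` to `tgt e`; it is used only to parametrize `e`
by the interval `[0, len e]`. -/
structure MetricGraph where
  /-- vertices -/
  V : Type
  /-- edges -/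
  E : Type
  [decEqV : DecidableEq V]
  [fintypeE : Fintype E]
  src : E → V
  tgt : E → V
  len : E → ℝ
  len_pos : ∀ e, 0 < len e

attribute [instance] MetricGraph.decEqV MetricGraph.fintypeE

namespace MetricGraph

variable (G : MetricGraph)

/-- The points of a metric graph: its vertices, and the interior points of its edges. -/
inductive Point : Type
  | vertex (v : G.V) : Point
  | inner (e : G.E) (t : ℝ) (h0 : 0 < t) (h1 : t < G.len e) : Point

variable {G}

/-- The point at distance `t` from the source along the edge `e`, for `0 ≤ t ≤ len e`
(`t = 0` is the source vertex and `t = len e` is the target vertex). -/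
def onEdge (e : G.E) (t : ℝ) : G.Point :=
  if h : 0 < t ∧ t < G.len e then .inner e t h.1 h.2
  else if t ≤ 0 then .vertex (G.src e) else .vertex (G.tgt e)

/-- `φ` is continuous and piecewise linear with integer slopes on `[a, b]`: there is a finite set `S`
of break points such that `φ` is affine with integer slope on every closed subinterval of `[a, b]`
whose interior misses `S`. (Continuity follows, as the pieces are closed intervals.) -/
def IsIntegralPLOn (φ : ℝ → ℝ) (a b : ℝ) : Prop :=
  ∃ S : Finset ℝ, ∀ x y : ℝ, a ≤ x → x ≤ y → y ≤ b → (∀ s ∈ S, ¬ (x < s ∧ s < y)) →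
    ∃ k : ℤ, ∀ t ∈ Set.Icc x y, φ t = φ x + k * (t - x)

/-- Membership in `PL(Γ)`: continuous piecewise linear functions with integer slopes. -/
def IsPL (f : G.Point → ℝ) : Prop :=
  ∀ e : G.E, IsIntegralPLOn (fun t => f (onEdge e t)) 0 (G.len e)

/-- The slope of `f` on `e` at parameter `t`, on the side of larger parameters,
in the direction from source to target. -/
def slopeRight (f : G.Point → ℝ) (e : G.E) (t : ℝ) : ℝ :=
  derivWithin (fun x => f (onEdge e x)) (Set.Ici t) t

/-- The slope of `f` on `e` at parameter `t`, on the side of smaller parameters,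
in the direction from source to target. -/
def slopeLeft (f : G.Point → ℝ) (e : G.E) (t : ℝ) : ℝ :=
  derivWithin (fun x => f (onEdge e x)) (Set.Iic t) t

/-- The order of `f` at a point: the sum of the incoming slopes of `f` along all tangent directions,
that is, minus the sum of the outgoing slopes. -/
def ord (f : G.Point → ℝ) : G.Point → ℝ
  | .vertex v =>
      ∑ e : G.E, ((if G.tgt e = v then slopeLeft f e (G.len e) else 0)
        - (if G.src e = v then slopeRight f e 0 else 0))
  | .inner e t _ _ => slopeLeft f e t - slopeRight f e t

variable (G) in
/-- Divisors: finite formal integer combinations of points. -/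
abbrev Divisor : Type := G.Point →₀ ℤ

/-- The degree of a divisor. -/
def deg (D : G.Divisor) : ℤ := D.sum fun _ n => n

/-- `f ∈ PL(Γ)` and `div f = D`. -/
def IsDiv (f : G.Point → ℝ) (D : G.Divisor) : Prop :=
  IsPL f ∧ ∀ p, ord f p = (D p : ℝ)

/-- Linear equivalence of divisors: `D' = D + div f` for some `f ∈ PL(Γ)`. -/
def LinEquiv (D D' : G.Divisor) : Prop := ∃ f : G.Point → ℝ, IsDiv f (D' - D)

/-- The Baker-Norine rank of `D` is at least `k`: for every effective divisor `E` of degree `k`,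
`D - E` is equivalent to an effective divisor. -/
def RankAtLeast (D : G.Divisor) (k : ℕ) : Prop :=
  ∀ E : G.Divisor, 0 ≤ E → deg E = k → ∃ D' : G.Divisor, 0 ≤ D' ∧ LinEquiv (D - E) D'

/-- The Baker-Norine rank of `D` equals the natural number `r`. -/
def HasRank (D : G.Divisor) (r : ℕ) : Prop := RankAtLeast D r ∧ ¬ RankAtLeast D (r + 1)

end MetricGraph

/-- The family `(ψ i)` indexed by `i ∈ A` is tropically dependent: for some real constants `b i`,
the minimum of the values `ψ i x + b i` occurs at least twice at every point `x`. -/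
def TropicallyDependent {X ι : Type} (A : Finset ι) (ψ : ι → X → ℝ) : Prop :=
  ∃ b : ι → ℝ, ∀ x : X, ∃ i ∈ A, ∃ j ∈ A, i ≠ j ∧
    ψ i x + b i = ψ j x + b j ∧ ∀ k ∈ A, ψ i x + b i ≤ ψ k x + b k

/-- Edge lengths for a chain of `g` loops: for `1 ≤ k ≤ g`, the top and bottom edges of the `k`-th
loop have lengths `ℓ k` and `m k`, and for `0 ≤ k ≤ g` the `k`-th bridge has length `n k`.
Values at other indices are never used. -/
structure ChainLengths (g : ℕ) where
  ℓ : ℕ → ℝ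
  m : ℕ → ℝ
  n : ℕ → ℝ
  ℓ_pos : ∀ k, 1 ≤ k → k ≤ g → 0 < ℓ k
  m_pos : ∀ k, 1 ≤ k → k ≤ g → 0 < m k
  n_pos : ∀ k, k ≤ g → 0 < n k

namespace ChainLengths

variable {g : ℕ}

/-- Admissible edge lengths, where `a ≪ b` is read as `C * a < b`. The last condition concerns the
division of the first `(r + 1) * s` loops into `r + 1` blocks of `s` consecutive loops. -/
structure Admissible (L : ChainLengths g) (r s : ℕ) (C : ℝ) : Prop where
  bottom_lt_top : ∀ k, 1 ≤ k → k ≤ g → 4 * (g : ℝ) * L.m k < L.ℓ k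
  top_ll_bridges : ∀ k, 1 ≤ k → k ≤ g → C * L.ℓ k < min (L.n (k - 1)) (L.n k)
  generic : ∀ c : ℕ → ℤ, (∀ k, 1 ≤ k → k ≤ g → |c k| ≤ (g : ℤ) + 1) →
    ∑ k ∈ Finset.Icc 1 g, (c k : ℝ) * L.m k = 0 → ∀ k, 1 ≤ k → k ≤ g → c k = 0
  blocks : ∀ α : ℕ, α ≤ r →
    C * (∑ i ∈ Finset.Icc (α * s + 1) ((α + 1) * s), L.ℓ i
        + ∑ i ∈ Finset.Ico (α * s + 1) ((α + 1) * s), L.n i)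
      < min (L.n (α * s)) (L.n ((α + 1) * s))

/-- The chain of `g` loops with bridges. The vertices are `inl k = w_k` and `inr k = v_{k+1}`, for
`0 ≤ k ≤ g`. The edges are the bridges `inl k`, from `w_k` to `v_{k+1}`, for `0 ≤ k ≤ g`, and the
top edges `inr (inl k)` and bottom edges `inr (inr k)` of the `(k+1)`-st loop, from `v_{k+1}` to
`w_{k+1}`, for `0 ≤ k < g`. -/
def graph (L : ChainLengths g) : MetricGraph where
  V := Fin (g + 1) ⊕ Fin (g + 1)
  E := Fin (g + 1) ⊕ (Fin g ⊕ Fin g)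
  src := Sum.elim (fun k => .inl k)
    (Sum.elim (fun k => .inr k.castSucc) (fun k => .inr k.castSucc))
  tgt := Sum.elim (fun k => .inr k)
    (Sum.elim (fun k => .inl k.succ) (fun k => .inl k.succ))
  len := Sum.elim (fun k => L.n k)
    (Sum.elim (fun k => L.ℓ (k + 1)) (fun k => L.m (k + 1)))
  len_pos := by
    rintro (k | k | k)
    · exact L.n_pos k (Nat.le_of_lt_succ k.isLt)
    · exact L.ℓ_pos (k + 1) (Nat.le_add_left 1 k) k.isLt
    · exact L.m_pos (k + 1) (Nat.le_add_left 1 k) k.isLt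

/-- The left end `w_0` of the chain. -/
def leftEnd (L : ChainLengths g) : L.graph.Point :=
  .vertex (.inl 0 : Fin (g + 1) ⊕ Fin (g + 1))

/-- The right end `v_{g+1}` of the chain. -/
def rightEnd (L : ChainLengths g) : L.graph.Point :=
  .vertex (.inr (Fin.last g) : Fin (g + 1) ⊕ Fin (g + 1))

/-- The divisor `i w_0 + (r - i) v_{g+1}`. -/
def endsDivisor (L : ChainLengths g) (r i : ℕ) : L.graph.Divisor :=
  Finsupp.single L.leftEnd (i : ℤ) + Finsupp.single L.rightEnd ((r : ℤ) - i)

/-- `D'` is equivalent to `D`, and `D' - (i w_0 + (r - i) v_{g+1})` is effective. -/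
def IsEndsRep (L : ChainLengths g) (D : L.graph.Divisor) (r i : ℕ) (D' : L.graph.Divisor) : Prop :=
  MetricGraph.LinEquiv D D' ∧ 0 ≤ D' - L.endsDivisor r i

/-- `D` has rank `r` and its class is vertex avoiding: for every `0 ≤ i ≤ r` there is exactly one
divisor `D_i` equivalent to `D` of the form `D_i = i w_0 + (r - i) v_{g+1} + E_i` with `E_i`
effective, and the support of `E_i` contains no vertex of the chain. (In particular `D_i` has
multiplicity exactly `i` at `w_0` and exactly `r - i` at `v_{g+1}`.) -/
def IsVertexAvoiding (L : ChainLengths g) (D : L.graph.Divisor) (r : ℕ) : Prop :=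
  MetricGraph.HasRank D r ∧
    ∀ i : ℕ, i ≤ r → ∃ D' : L.graph.Divisor, L.IsEndsRep D r i D' ∧
      (∀ D'' : L.graph.Divisor, L.IsEndsRep D r i D'' → D'' = D') ∧
      ∀ v : L.graph.V, (D' - L.endsDivisor r i) (.vertex v) = 0

end ChainLengths

/-- The tropical maximal rank conjecture for the parameters `(g, r, d, m)`: on every chain of `g`
loops with admissible edge lengths there are a divisor `D` of rank `r` and degree `d` whose class is
vertex avoiding, with associated divisors `Di i ∼ D` for `0 ≤ i ≤ r`, and functions `ψ I` with
`m D + div (ψ I) = ∑ i ∈ I, Di i` for the multisets `I` of size `m` in `{0, …, r}`, such that some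
set `A` of `min (choose (r + m) m) (m d - g + 1)` of these functions is tropically independent.
The constant `C` says how much smaller `≪` has to mean; it depends on `g, r, d, m` only. -/
def TropicalMaximalRank (g r d m : ℕ) : Prop :=
  ∃ C : ℝ, 0 < C ∧ ∀ L : ChainLengths g, L.Admissible r (g + r - d) C →
    ∃ D : L.graph.Divisor, MetricGraph.deg D = d ∧ L.IsVertexAvoiding D r ∧
      ∃ Di : Fin (r + 1) → L.graph.Divisor, (∀ i : Fin (r + 1), L.IsEndsRep D r i (Di i)) ∧
      ∃ ψ : Sym (Fin (r + 1)) m → L.graph.Point → ℝ,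
        (∀ I, MetricGraph.IsDiv (ψ I) (((I : Multiset (Fin (r + 1))).map Di).sum - m • D)) ∧
      ∃ A : Finset (Sym (Fin (r + 1)) m),
        (A.card : ℤ) = min (((r + m).choose m : ℕ) : ℤ) ((m : ℤ) * d - g + 1) ∧
        ¬ TropicallyDependent A ψ

end

noncomputable section

/-! ### Piecewise linear functions on an interval -/

namespace MetricGraph

/-! Take for D the canonical divisor: the trivalent vertices minus the two ends. Loops are numbered
from 0 to r in what follows.

The Jacobian of the chain is the product of its loops (`linEquiv_iff`): two divisors are equivalent
when their degrees agree and, on every loop, the sums of the positions of their chips, retracted to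
that loop, agree modulo the circumference. An effective divisor without a chip on a loop is seen
there only through the number of chips to the right of the loop, times the bottom length. As the top
edges are long, the class determines this number. Rank and vertex avoidance thus become counting
problems, and D_i turns out to be i w_0 + (r - i) v_{g+1} plus one chip on the top edge of every
loop except loop i.

Let φ_i be the function with divisor D_i - D. Going right along bridges and bottom edges, φ_{i-1} -
φ_i has slope 1, except for slope 2 on bridge i. Up to normalization it is therefore X, the distance
from the left end, plus the part of bridge i already covered (`endsFun_sub_succ`).

Independence follows once constants are found for which each function is the only minimum at some
point (`not_tropicallyDependent_image`). The points lie on the bridges 0, …, r, each cut into 2m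
steps. A window of m indices slides from (0, …, 0) to (r, …, r), changing one index j - 1 to j at a
time. This gives rm + 1 sums of φ's whose consecutive differences are strictly increasing along the
walk, so constants make the sums for E and E + 1 cross exactly at step 2E; the E-th sum is then
alone at the bottom at step 2E - 1.

At a crossing in the interior of bridge j one more function fits in. Replacing a pair j, j by j - 1,
j + 1 adds the covered part of bridge j minus that of bridge j + 1. Lowered by half a step, the
resulting function goes below the family at that crossing and at no other step. On bridge r the
mirror image is used, with j - 1, j - 1 replaced by j - 2, j; this needs r ≥ 2. Only the r crossings
at starts of bridges and the very last crossing are lost. For m ≥ 2 the total is (rm + 1) + (rm - r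
- 1) = 2rm - r = md - g + 1; for m = 1 there is one function to spare. -/

theorem IsIntegralPLOn.add {φ χ : ℝ → ℝ} {a b : ℝ} (hφ : IsIntegralPLOn φ a b)
    (hχ : IsIntegralPLOn χ a b) : IsIntegralPLOn (fun t => φ t + χ t) a b := by
  classical
  obtain ⟨S, hS⟩ := hφ
  obtain ⟨T, hT⟩ := hχ
  refine ⟨S ∪ T, fun x y hx hxy hy h => ?_⟩
  obtain ⟨k, hk⟩ := hS x y hx hxy hy fun s hs => h s (Finset.mem_union_left _ hs)
  obtain ⟨l, hl⟩ := hT x y hx hxy hy fun s hs => h s (Finset.mem_union_right _ hs)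
  refine ⟨k + l, fun t ht => ?_⟩
  simp only [hk t ht, hl t ht]
  push_cast
  ring

theorem isIntegralPLOn_affine (c : ℝ) (k : ℤ) (a b : ℝ) :
    IsIntegralPLOn (fun t => c + k * t) a b :=
  ⟨∅, fun x y _ _ _ _ => ⟨k, fun t _ => by ring⟩⟩

theorem isIntegralPLOn_hinge (n : ℤ) (s a b : ℝ) :
    IsIntegralPLOn (fun t => n * max (t - s) 0) a b := by
  refine ⟨{s}, fun x y _ hxy _ h => ?_⟩
  have h' := h s (Finset.mem_singleton_self s)
  rcases le_or_gt s x with hs | hs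
  · refine ⟨n, fun t ht => ?_⟩
    have h1 := ht.1
    simp only [max_eq_left (sub_nonneg.2 hs), max_eq_left (sub_nonneg.2 (hs.trans h1))]
    ring
  · refine ⟨0, fun t ht => ?_⟩
    have hy : y ≤ s := by
      by_contra! hy
      exact h' ⟨hs, hy⟩
    have h2 := ht.2
    simp only [max_eq_right (sub_nonpos.2 hs.le), max_eq_right (sub_nonpos.2 (h2.trans hy))]
    simp

theorem IsIntegralPLOn.congr {φ χ : ℝ → ℝ} {a b : ℝ} (hφ : IsIntegralPLOn φ a b)
    (h : ∀ t ∈ Set.Icc a b, χ t = φ t) : IsIntegralPLOn χ a b := by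
  obtain ⟨S, hS⟩ := hφ
  refine ⟨S, fun x y hx hxy hy hs => ?_⟩
  obtain ⟨k, hk⟩ := hS x y hx hxy hy hs
  refine ⟨k, fun t ht => ?_⟩
  rw [h t ⟨hx.trans ht.1, ht.2.trans hy⟩, h x ⟨hx, hxy.trans hy⟩, hk t ht]

theorem exists_right_of_finset (S : Finset ℝ) {t b : ℝ} (h : t < b) :
    ∃ y, t < y ∧ y ≤ b ∧ ∀ s ∈ S, ¬ (t < s ∧ s < y) := by
  induction S using Finset.induction_on with
  | empty => exact ⟨b, h, le_rfl, by simp⟩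
  | insert s S _ ih =>
    obtain ⟨y, hy, hyb, hS⟩ := ih
    by_cases hs : t < s ∧ s < y
    · refine ⟨s, hs.1, hs.2.le.trans hyb, fun u hu hu' => ?_⟩
      rcases Finset.mem_insert.1 hu with rfl | hu
      · exact lt_irrefl _ hu'.2
      · exact hS u hu ⟨hu'.1, hu'.2.trans hs.2⟩
    · refine ⟨y, hy, hyb, fun u hu => ?_⟩
      rcases Finset.mem_insert.1 hu with rfl | hu
      · exact hs
      · exact hS u hu

theorem exists_left_of_finset (S : Finset ℝ) {t a : ℝ} (h : a < t) :
    ∃ y, y < t ∧ a ≤ y ∧ ∀ s ∈ S, ¬ (y < s ∧ s < t) := by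
  induction S using Finset.induction_on with
  | empty => exact ⟨a, h, le_rfl, by simp⟩
  | insert s S _ ih =>
    obtain ⟨y, hy, hya, hS⟩ := ih
    by_cases hs : y < s ∧ s < t
    · refine ⟨s, hs.2, hya.trans hs.1.le, fun u hu hu' => ?_⟩
      rcases Finset.mem_insert.1 hu with rfl | hu
      · exact lt_irrefl _ hu'.1
      · exact hS u hu ⟨hs.1.trans hu'.1, hu'.2⟩
    · refine ⟨y, hy, hya, fun u hu => ?_⟩
      rcases Finset.mem_insert.1 hu with rfl | hu
      · exact hs
      · exact hS u hu

theorem hasDerivWithinAt_Ici_of_affine {φ : ℝ → ℝ} {t y k : ℝ} (hy : t < y)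
    (h : ∀ u ∈ Set.Icc t y, φ u = φ t + k * (u - t)) : HasDerivWithinAt φ k (Set.Ici t) t := by
  have h0 : HasDerivWithinAt (fun u => φ t + k * (u - t)) k (Set.Ici t) t := by
    simpa using (((hasDerivAt_id t).sub_const t).const_mul k).const_add (φ t) |>.hasDerivWithinAt
  refine h0.congr_of_eventuallyEq ?_ (by simp)
  filter_upwards [Icc_mem_nhdsGE hy] with u hu using h u hu

theorem hasDerivWithinAt_Iic_of_affine {φ : ℝ → ℝ} {t y k c : ℝ} (hy : y < t)
    (h : ∀ u ∈ Set.Icc y t, φ u = c + k * (u - y)) : HasDerivWithinAt φ k (Set.Iic t) t := by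
  have h0 : HasDerivWithinAt (fun u => c + k * (u - y)) k (Set.Iic t) t := by
    simpa using (((hasDerivAt_id t).sub_const y).const_mul k).const_add c |>.hasDerivWithinAt
  refine h0.congr_of_eventuallyEq ?_ (h t ⟨hy.le, le_rfl⟩)
  filter_upwards [Icc_mem_nhdsLE hy] with u hu using h u hu

theorem IsIntegralPLOn.exists_hasDerivWithinAt_Ici {φ : ℝ → ℝ} {a b t : ℝ}
    (hφ : IsIntegralPLOn φ a b) (ha : a ≤ t) (hb : t < b) :
    ∃ k : ℤ, HasDerivWithinAt φ k (Set.Ici t) t := by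
  obtain ⟨S, hS⟩ := hφ
  obtain ⟨y, hy, hyb, hyS⟩ := exists_right_of_finset S hb
  obtain ⟨k, hk⟩ := hS t y ha hy.le hyb hyS
  exact ⟨k, hasDerivWithinAt_Ici_of_affine hy hk⟩

theorem IsIntegralPLOn.exists_hasDerivWithinAt_Iic {φ : ℝ → ℝ} {a b t : ℝ}
    (hφ : IsIntegralPLOn φ a b) (ha : a < t) (hb : t ≤ b) :
    ∃ k : ℤ, HasDerivWithinAt φ k (Set.Iic t) t := by
  obtain ⟨S, hS⟩ := hφ
  obtain ⟨y, hy, hya, hyS⟩ := exists_left_of_finset S ha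
  obtain ⟨k, hk⟩ := hS y t hya hy.le hb hyS
  exact ⟨k, hasDerivWithinAt_Iic_of_affine hy hk⟩

/-- A piecewise linear function whose one-sided slopes agree at every interior point is affine. -/
theorem IsIntegralPLOn.affine_of_no_kinks {φ : ℝ → ℝ} {a b : ℝ} (hab : a ≤ b)
    (hφ : IsIntegralPLOn φ a b)
    (h : ∀ t, a < t → t < b → derivWithin φ (Set.Iic t) t = derivWithin φ (Set.Ici t) t) :
    ∃ k : ℤ, ∀ t ∈ Set.Icc a b, φ t = φ a + k * (t - a) := by
  classical
  obtain ⟨S, hS⟩ := hφ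
  induction S using Finset.induction_on with
  | empty => exact hS a b le_rfl hab le_rfl (by simp)
  | insert s S _ ih =>
    -- The break points are removed one by one: at s the two adjacent affine pieces have equal
    -- slopes, so they merge.
    refine ih fun x y hx hxy hy hxyS => ?_
    by_cases hs : x < s ∧ s < y
    · obtain ⟨k, hk⟩ := hS x s hx hs.1.le (hs.2.le.trans hy) (by
        intro u hu hu'
        rcases Finset.mem_insert.1 hu with rfl | hu
        · exact lt_irrefl _ hu'.2
        · exact hxyS u hu ⟨hu'.1, hu'.2.trans hs.2⟩)
      obtain ⟨l, hl⟩ := hS s y (hx.trans hs.1.le) hs.2.le hy (by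
        intro u hu hu'
        rcases Finset.mem_insert.1 hu with rfl | hu
        · exact lt_irrefl _ hu'.1
        · exact hxyS u hu ⟨hs.1.trans hu'.1, hu'.2⟩)
      have hkl : (k : ℝ) = l := by
        rw [← (hasDerivWithinAt_Iic_of_affine hs.1 hk).derivWithin (uniqueDiffOn_Iic s s (by simp)),
          ← (hasDerivWithinAt_Ici_of_affine hs.2 hl).derivWithin (uniqueDiffOn_Ici s s (by simp))]
        exact h s (hx.trans_lt hs.1) (hs.2.trans_le hy)
      refine ⟨k, fun t ht => ?_⟩
      rcases le_total t s with hts | hts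
      · exact hk t ⟨ht.1, hts⟩
      · rw [hl t ⟨hts, ht.2⟩, hk s ⟨hs.1.le, le_rfl⟩, hkl]
        ring
    · exact hS x y hx hxy hy fun u hu => by
        rcases Finset.mem_insert.1 hu with rfl | hu
        · exact hs
        · exact hxyS u hu

/-! ### Pairing divisors with functions -/

variable {G : MetricGraph} {R : Type*} [CommRing R]

/-- The sum of the values of `w`, weighted by the coefficients of the divisor. -/
def pairing (w : G.Point → R) : G.Divisor →+ R :=
  Finsupp.liftAddHom fun x => (AddMonoidHom.mulRight (w x)).comp (Int.castAddHom R)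

theorem pairing_apply (w : G.Point → R) (F : G.Divisor) :
    pairing w F = F.sum fun x n => (n : R) * w x := rfl

@[simp] theorem pairing_single (w : G.Point → R) (x : G.Point) (n : ℤ) :
    pairing w (Finsupp.single x n) = n * w x := by
  simp [pairing]

theorem pairing_const_one (F : G.Divisor) : pairing (fun _ => (1 : ℤ)) F = deg F := by
  simp [pairing_apply, deg]

theorem intCast_pairing (w : G.Point → ℤ) (F : G.Divisor) :
    ((pairing w F : ℤ) : R) = pairing (fun x => (w x : R)) F := by
  simp [pairing_apply, Finsupp.sum]

theorem pairing_add_left (w w' : G.Point → R) (F : G.Divisor) :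
    pairing (fun x => w x + w' x) F = pairing w F + pairing w' F := by
  simp [pairing_apply, Finsupp.sum, mul_add, Finset.sum_add_distrib]

theorem pairing_sub_left (w w' : G.Point → R) (F : G.Divisor) :
    pairing (fun x => w x - w' x) F = pairing w F - pairing w' F := by
  simp [pairing_apply, Finsupp.sum, mul_sub, Finset.sum_sub_distrib]

theorem pairing_mul_left (c : R) (w : G.Point → R) (F : G.Divisor) :
    pairing (fun x => c * w x) F = c * pairing w F := by
  simp [pairing_apply, Finsupp.sum, Finset.mul_sum, mul_left_comm]

theorem pairing_zero_left (F : G.Divisor) : pairing (fun _ => (0 : R)) F = 0 := by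
  simp [pairing_apply]

theorem pairing_sum_left {ι : Type*} (s : Finset ι) (w : ι → G.Point → R) (F : G.Divisor) :
    pairing (fun x => ∑ i ∈ s, w i x) F = ∑ i ∈ s, pairing (w i) F := by
  simp only [pairing_apply, Finsupp.sum, Finset.mul_sum]
  exact Finset.sum_comm

theorem pairing_mono [PartialOrder R] [IsOrderedRing R] {w w' : G.Point → R} (h : ∀ x, w x ≤ w' x)
    {F : G.Divisor} (hF : 0 ≤ F) : pairing w F ≤ pairing w' F := by
  simp only [pairing_apply, Finsupp.sum]
  exact Finset.sum_le_sum fun x _ =>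
    mul_le_mul_of_nonneg_left (h x) (Int.cast_nonneg (show (0 : ℤ) ≤ F x from hF x))

open Classical in
/-- The function that is `φ` in the interior of the edge `e` and zero elsewhere. -/
def innerOn (e : G.E) (φ : ℝ → R) : G.Point → R
  | .vertex _ => 0
  | .inner e' t _ _ => if e' = e then φ t else 0

theorem innerOn_congr {e : G.E} {φ χ : ℝ → R} (h : ∀ t, 0 < t → t < G.len e → φ t = χ t) :
    (innerOn e φ : G.Point → R) = innerOn e χ := by
  funext x
  cases x with
  | vertex v => rfl
  | inner e' t h0 h1 =>
    simp only [innerOn]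
    split_ifs with he
    · subst he
      exact h t h0 h1
    · rfl

theorem innerOn_zero (e : G.E) : (innerOn e fun _ => (0 : R) : G.Point → R) = fun _ => 0 := by
  funext x
  cases x <;> simp [innerOn]

/-- The number of chips of a divisor in the interior of an edge. -/
def edgeDeg (e : G.E) : G.Divisor →+ ℤ := pairing (innerOn e fun _ => 1)

/-- The first moment of the chips of a divisor in the interior of an edge. -/
def edgeMoment (e : G.E) : G.Divisor →+ ℝ := pairing (innerOn e fun t => t)

/-- The function on an edge with the kinks prescribed by a divisor, and with value and slope zero
at the source. -/
def bend (F : G.Divisor) (e : G.E) (t : ℝ) : ℝ := pairing (innerOn e fun a => max (t - a) 0) F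

theorem intCast_edgeDeg (e : G.E) (F : G.Divisor) :
    ((edgeDeg e F : ℤ) : R) = pairing (innerOn e fun _ => (1 : R)) F := by
  rw [edgeDeg, intCast_pairing]
  congr 2
  funext x
  cases x <;> simp [innerOn]

theorem bend_zero (F : G.Divisor) (e : G.E) : bend F e 0 = 0 := by
  rw [bend, innerOn_congr (χ := fun _ => (0 : ℝ))]
  · rw [innerOn_zero, pairing_zero_left]
  · intro t h0 _
    simpa using h0.le

theorem bend_len (F : G.Divisor) (e : G.E) :
    bend F e (G.len e) = G.len e * edgeDeg e F - edgeMoment e F := by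
  rw [bend, innerOn_congr (χ := fun t => G.len e - t) (fun t _ h1 => by simpa using h1.le),
    intCast_edgeDeg, edgeMoment, ← pairing_mul_left, ← pairing_sub_left]
  congr 2
  funext x
  cases x <;> simp [innerOn]
  split_ifs <;> simp

theorem bend_zero_left (e : G.E) : bend (0 : G.Divisor) e = fun _ => 0 := by
  funext t
  simp [bend]

theorem bend_add (F F' : G.Divisor) (e : G.E) :
    bend (F + F') e = fun t => bend F e t + bend F' e t := by
  funext t
  simp [bend]

theorem bend_single_vertex (v : G.V) (n : ℤ) (e : G.E) :
    bend (Finsupp.single (.vertex v) n) e = fun _ => 0 := by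
  funext t
  simp [bend, innerOn]

theorem bend_single_inner (e : G.E) (s : ℝ) (h0 : 0 < s) (h1 : s < G.len e) (n : ℤ) :
    bend (Finsupp.single (.inner e s h0 h1) n) e = fun t => n * max (t - s) 0 := by
  funext t
  simp [bend, innerOn]

theorem bend_single_inner_of_ne {e e' : G.E} (he : e' ≠ e) (s : ℝ) (h0 : 0 < s)
    (h1 : s < G.len e') (n : ℤ) :
    bend (Finsupp.single (.inner e' s h0 h1) n) e = fun _ => 0 := by
  funext t
  simp [bend, innerOn, he]

theorem isIntegralPLOn_bend (F : G.Divisor) (e : G.E) (a b : ℝ) :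
    IsIntegralPLOn (bend F e) a b := by
  have h0 : IsIntegralPLOn (fun _ => (0 : ℝ)) a b := by
    simpa using isIntegralPLOn_affine 0 0 a b
  induction F using Finsupp.induction_linear with
  | zero => rwa [bend_zero_left]
  | add F F' h h' => rw [bend_add]; exact h.add h'
  | single x n =>
    cases x with
    | vertex v => rwa [bend_single_vertex]
    | inner e' s _ _ =>
      by_cases he : e' = e
      · subst he
        rw [bend_single_inner]
        exact isIntegralPLOn_hinge n s a b
      · rwa [bend_single_inner_of_ne he]

theorem hasDerivWithinAt_hinge_Ici (s t : ℝ) :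
    HasDerivWithinAt (fun u => max (u - s) 0) (if s ≤ t then 1 else 0) (Set.Ici t) t := by
  split_ifs with h
  · refine hasDerivWithinAt_Ici_of_affine (lt_add_one t) fun u hu => ?_
    rw [max_eq_left (sub_nonneg.2 h), max_eq_left (sub_nonneg.2 (h.trans hu.1))]
    ring
  · push Not at h
    refine hasDerivWithinAt_Ici_of_affine h fun u hu => ?_
    rw [max_eq_right (sub_nonpos.2 h.le), max_eq_right (sub_nonpos.2 hu.2)]
    ring

theorem hasDerivWithinAt_hinge_Iic (s t : ℝ) :
    HasDerivWithinAt (fun u => max (u - s) 0) (if s < t then 1 else 0) (Set.Iic t) t := by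
  split_ifs with h
  · refine hasDerivWithinAt_Iic_of_affine (c := 0) h fun u hu => ?_
    rw [max_eq_left (sub_nonneg.2 hu.1)]
    ring
  · push Not at h
    refine hasDerivWithinAt_Iic_of_affine (c := 0) (sub_one_lt t) fun u hu => ?_
    rw [max_eq_right (sub_nonpos.2 (hu.2.trans h))]
    ring

theorem hasDerivWithinAt_bend_Ici (F : G.Divisor) (e : G.E) (t : ℝ) :
    HasDerivWithinAt (bend F e) (pairing (innerOn e fun a => if a ≤ t then (1 : ℝ) else 0) F)
      (Set.Ici t) t := by
  have h0 := hasDerivWithinAt_const t (Set.Ici t) (0 : ℝ)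
  induction F using Finsupp.induction_linear with
  | zero => rw [bend_zero_left, map_zero]; exact h0
  | add F F' h h' => rw [bend_add, map_add]; exact h.add h'
  | single x n =>
    cases x with
    | vertex v => rw [bend_single_vertex]; simpa [innerOn] using h0
    | inner e' s _ _ =>
      by_cases he : e' = e
      · subst he
        rw [bend_single_inner]
        simpa [innerOn] using (hasDerivWithinAt_hinge_Ici s t).const_mul (n : ℝ)
      · rw [bend_single_inner_of_ne he]
        simpa [innerOn, he] using h0

theorem hasDerivWithinAt_bend_Iic (F : G.Divisor) (e : G.E) (t : ℝ) :
    HasDerivWithinAt (bend F e) (pairing (innerOn e fun a => if a < t then (1 : ℝ) else 0) F)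
      (Set.Iic t) t := by
  have h0 := hasDerivWithinAt_const t (Set.Iic t) (0 : ℝ)
  induction F using Finsupp.induction_linear with
  | zero => rw [bend_zero_left, map_zero]; exact h0
  | add F F' h h' => rw [bend_add, map_add]; exact h.add h'
  | single x n =>
    cases x with
    | vertex v => rw [bend_single_vertex]; simpa [innerOn] using h0
    | inner e' s _ _ =>
      by_cases he : e' = e
      · subst he
        rw [bend_single_inner]
        simpa [innerOn] using (hasDerivWithinAt_hinge_Iic s t).const_mul (n : ℝ)
      · rw [bend_single_inner_of_ne he]
        simpa [innerOn, he] using h0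

/-- The two pairings are the right and left slopes of `bend F e` at t, so the kink of `bend` there
is the coefficient of the divisor. -/
theorem pairing_innerOn_le_sub_lt (F : G.Divisor) (e : G.E) {t : ℝ} (h0 : 0 < t)
    (h1 : t < G.len e) :
    pairing (innerOn e fun a => if a ≤ t then (1 : ℝ) else 0) F
      - pairing (innerOn e fun a => if a < t then (1 : ℝ) else 0) F = F (.inner e t h0 h1) := by
  induction F using Finsupp.induction_linear with
  | zero => simp
  | add F F' h h' =>
    simp only [map_add, Finsupp.add_apply]
    push_cast
    linarith
  | single x n =>
    cases x with
    | vertex v => simp [innerOn]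
    | inner e' s h0' h1' =>
      classical
      rw [Finsupp.single_apply]
      by_cases he : e' = e
      · subst he
        rcases lt_trichotomy s t with h | h | h
        · simp [innerOn, h, h.le, h.ne]
        · subst h
          simp [innerOn]
        · simp [innerOn, h.not_gt, h.not_ge, h.ne']
      · simp [innerOn, he]

/-! ### The functions with a given divisor -/

theorem onEdge_inner (e : G.E) {t : ℝ} (h0 : 0 < t) (h1 : t < G.len e) :
    onEdge e t = .inner e t h0 h1 := by
  simp [onEdge, h0, h1]

@[simp] theorem onEdge_zero (e : G.E) : onEdge e 0 = .vertex (G.src e) := by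
  simp [onEdge]

@[simp] theorem onEdge_len (e : G.E) : onEdge e (G.len e) = .vertex (G.tgt e) := by
  simp [onEdge, (G.len_pos e).not_ge]

section Slopes

variable {f : G.Point → ℝ} {F : G.Divisor} {e : G.E} {c : ℝ} {k : ℤ}

theorem slopeRight_eq (h : ∀ t ∈ Set.Icc 0 (G.len e), f (onEdge e t) = c + k * t - bend F e t)
    {t : ℝ} (h0 : 0 ≤ t) (h1 : t < G.len e) :
    slopeRight f e t = k - pairing (innerOn e fun a => if a ≤ t then (1 : ℝ) else 0) F := by
  have h2 : HasDerivWithinAt (fun t => c + k * t) k (Set.Ici t) t := by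
    simpa using ((hasDerivAt_id t).const_mul (k : ℝ)).const_add c |>.hasDerivWithinAt
  refine ((h2.sub (hasDerivWithinAt_bend_Ici F e t)).congr_of_eventuallyEq ?_
    (h t ⟨h0, h1.le⟩)).derivWithin (uniqueDiffOn_Ici t t (by simp))
  filter_upwards [Icc_mem_nhdsGE h1] with u hu using h u ⟨h0.trans hu.1, hu.2⟩

theorem slopeLeft_eq (h : ∀ t ∈ Set.Icc 0 (G.len e), f (onEdge e t) = c + k * t - bend F e t)
    {t : ℝ} (h0 : 0 < t) (h1 : t ≤ G.len e) :
    slopeLeft f e t = k - pairing (innerOn e fun a => if a < t then (1 : ℝ) else 0) F := by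
  have h2 : HasDerivWithinAt (fun t => c + k * t) k (Set.Iic t) t := by
    simpa using ((hasDerivAt_id t).const_mul (k : ℝ)).const_add c |>.hasDerivWithinAt
  refine ((h2.sub (hasDerivWithinAt_bend_Iic F e t)).congr_of_eventuallyEq ?_
    (h t ⟨h0.le, h1⟩)).derivWithin (uniqueDiffOn_Iic t t (by simp))
  filter_upwards [Icc_mem_nhdsLE h0] with u hu using h u ⟨hu.1, hu.2.trans h1⟩

theorem slopeRight_zero_eq
    (h : ∀ t ∈ Set.Icc 0 (G.len e), f (onEdge e t) = c + k * t - bend F e t) :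
    slopeRight f e 0 = k := by
  rw [slopeRight_eq h le_rfl (G.len_pos e),
    innerOn_congr (χ := fun _ => (0 : ℝ)) (fun t h0 _ => if_neg h0.not_ge)]
  rw [innerOn_zero, pairing_zero_left, sub_zero]

theorem slopeLeft_len_eq
    (h : ∀ t ∈ Set.Icc 0 (G.len e), f (onEdge e t) = c + k * t - bend F e t) :
    slopeLeft f e (G.len e) = (k - edgeDeg e F : ℤ) := by
  rw [slopeLeft_eq h (G.len_pos e) le_rfl,
    innerOn_congr (χ := fun _ => (1 : ℝ)) (fun t _ h1 => if_pos h1), Int.cast_sub, intCast_edgeDeg]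

end Slopes

/-- The divisor of net flows into the vertices, for a flow with value `k e` at the source of `e`
which loses `F` along the edges. -/
def netFlow (F : G.Divisor) (k : G.E → ℤ) (v : G.V) : ℤ :=
  ∑ e : G.E, ((if G.tgt e = v then k e - edgeDeg e F else 0) - (if G.src e = v then k e else 0))

theorem ord_vertex_eq {f : G.Point → ℝ} {F : G.Divisor} {k : G.E → ℤ}
    (h : ∀ e, ∀ t ∈ Set.Icc 0 (G.len e),
      f (onEdge e t) = f (.vertex (G.src e)) + k e * t - bend F e t) (v : G.V) :
    ord f (.vertex v) = netFlow F k v := by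
  simp only [ord, netFlow, Int.cast_sum]
  refine Finset.sum_congr rfl fun e _ => ?_
  rw [slopeRight_zero_eq (h e), slopeLeft_len_eq (h e)]
  split_ifs <;> simp

/-- Adding `bend F e` cancels the kinks of f inside the edge e and leaves an affine function. What
remains is one integer slope per edge, and the condition at the vertices becomes conservation of a
flow. -/
theorem isDiv_iff (f : G.Point → ℝ) (F : G.Divisor) :
    IsDiv f F ↔ ∃ k : G.E → ℤ, (∀ e, ∀ t ∈ Set.Icc 0 (G.len e),
      f (onEdge e t) = f (.vertex (G.src e)) + k e * t - bend F e t) ∧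
      ∀ v, F (.vertex v) = netFlow F k v := by
  constructor
  · rintro ⟨hPL, hord⟩
    have key : ∀ e, ∃ k : ℤ, ∀ t ∈ Set.Icc 0 (G.len e),
        f (onEdge e t) = f (.vertex (G.src e)) + k * t - bend F e t := by
      intro e
      have h1 : IsIntegralPLOn (fun t => f (onEdge e t) + bend F e t) 0 (G.len e) :=
        (hPL e).add (isIntegralPLOn_bend F e _ _)
      obtain ⟨k, hk⟩ := h1.affine_of_no_kinks (G.len_pos e).le (by
        intro t ht0 ht1
        obtain ⟨l, hl⟩ := (hPL e).exists_hasDerivWithinAt_Iic ht0 ht1.le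
        obtain ⟨l', hl'⟩ := (hPL e).exists_hasDerivWithinAt_Ici ht0.le ht1
        have ho := hord (.inner e t ht0 ht1)
        simp only [ord, slopeLeft, slopeRight] at ho
        rw [hl.derivWithin (uniqueDiffOn_Iic t t (by simp)),
          hl'.derivWithin (uniqueDiffOn_Ici t t (by simp)),
          ← pairing_innerOn_le_sub_lt F e ht0 ht1] at ho
        have d1 := (hl.add (hasDerivWithinAt_bend_Iic F e t)).derivWithin
          (uniqueDiffOn_Iic t t (by simp))
        have d2 := (hl'.add (hasDerivWithinAt_bend_Ici F e t)).derivWithin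
          (uniqueDiffOn_Ici t t (by simp))
        refine d1.trans (Eq.trans ?_ d2.symm)
        linarith)
      refine ⟨k, fun t ht => ?_⟩
      have := hk t ht
      simp only [onEdge_zero, bend_zero] at this
      linarith
    choose k hk using key
    refine ⟨k, hk, fun v => ?_⟩
    have := ord_vertex_eq hk v
    rw [hord] at this
    exact_mod_cast this
  · rintro ⟨k, hk, hv⟩
    refine ⟨fun e => ?_, fun p => ?_⟩
    · have hb := isIntegralPLOn_bend (-F) e 0 (G.len e)
      refine ((isIntegralPLOn_affine (f (.vertex (G.src e))) (k e) 0 (G.len e)).add hb).congr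
        fun t ht => ?_
      rw [hk e t ht]
      simp [bend, sub_eq_add_neg]
    · cases p with
      | vertex v => rw [ord_vertex_eq hk v, hv v]
      | inner e t h0 h1 =>
        simp only [ord]
        rw [slopeLeft_eq (hk e) h0 h1.le, slopeRight_eq (hk e) h0.le h1,
          ← pairing_innerOn_le_sub_lt F e h0 h1]
        ring

/-- The increment along an edge of a function with divisor `F` and initial slope `k e`. -/
def rise (F : G.Divisor) (k : G.E → ℤ) (e : G.E) : ℝ :=
  (k e - edgeDeg e F : ℤ) * G.len e + edgeMoment e F

/-- A potential on the vertices that is compatible with a flow extends to a function with the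
given divisor. -/
theorem exists_isDiv (F : G.Divisor) (k : G.E → ℤ) (P : G.V → ℝ)
    (hP : ∀ e, P (G.tgt e) = P (G.src e) + rise F k e)
    (hv : ∀ v, F (.vertex v) = netFlow F k v) :
    ∃ f : G.Point → ℝ, IsDiv f F ∧ ∀ e, ∀ t ∈ Set.Icc 0 (G.len e),
      f (onEdge e t) = P (G.src e) + k e * t - bend F e t := by
  let f : G.Point → ℝ
    | .vertex v => P v
    | .inner e t _ _ => P (G.src e) + k e * t - bend F e t
  have hf : ∀ e, ∀ t ∈ Set.Icc 0 (G.len e),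
      f (onEdge e t) = P (G.src e) + k e * t - bend F e t := by
    intro e t ht
    rcases ht.1.eq_or_lt with rfl | h0
    · simp [f, bend_zero]
    · rcases ht.2.eq_or_lt with rfl | h1
      · rw [onEdge_len, bend_len]
        change P (G.tgt e) = _
        rw [hP, rise]
        push_cast
        ring
      · rw [onEdge_inner e h0 h1]
  exact ⟨f, (isDiv_iff f F).2 ⟨k, hf, hv⟩, hf⟩

theorem rise_eq_sub {f : G.Point → ℝ} {F : G.Divisor} {k : G.E → ℤ}
    (h : ∀ e, ∀ t ∈ Set.Icc 0 (G.len e),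
      f (onEdge e t) = f (.vertex (G.src e)) + k e * t - bend F e t) (e : G.E) :
    rise F k e = f (.vertex (G.tgt e)) - f (.vertex (G.src e)) := by
  have := h e (G.len e) ⟨(G.len_pos e).le, le_rfl⟩
  rw [onEdge_len, bend_len] at this
  rw [this, rise]
  push_cast
  ring

/-! ### Summation by parts -/

theorem pairing_eq_sum [Fintype G.V] (w : G.Point → R) (F : G.Divisor) :
    pairing w F = ∑ v, F (.vertex v) * w (.vertex v)
      + ∑ e, pairing (innerOn e fun t => w (onEdge e t)) F := by
  induction F using Finsupp.induction_linear with
  | zero => simp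
  | add F F' h h' =>
    simp only [map_add, Finsupp.add_apply, Int.cast_add, add_mul, Finset.sum_add_distrib, h, h']
    ring
  | single x n =>
    classical
    cases x with
    | vertex v => simp [innerOn, Finsupp.single_apply]
    | inner e s h0 h1 =>
      simp [innerOn, onEdge_inner e h0 h1]

theorem sum_netFlow_mul [Fintype G.V] (F : G.Divisor) (k : G.E → ℤ) (u : G.V → R) :
    ∑ v, (netFlow F k v : R) * u v =
      ∑ e, ((k e - edgeDeg e F : ℤ) * u (G.tgt e) - k e * u (G.src e)) := by
  simp only [netFlow, Int.cast_sum, Finset.sum_mul]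
  rw [Finset.sum_comm]
  refine Finset.sum_congr rfl fun e _ => ?_
  simp [sub_mul, Finset.sum_sub_distrib, ite_mul]

/-- Summation by parts: the vertex coefficients are traded for flows, so that an edge on which w is
constant contributes nothing. -/
theorem pairing_eq_sum_edges [Fintype G.V] (w : G.Point → R) {F : G.Divisor} {k : G.E → ℤ}
    (hv : ∀ v, F (.vertex v) = netFlow F k v) :
    pairing w F = ∑ e, ((k e - edgeDeg e F : ℤ) * w (.vertex (G.tgt e))
      - k e * w (.vertex (G.src e)) + pairing (innerOn e fun t => w (onEdge e t)) F) := by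
  rw [pairing_eq_sum, Finset.sum_add_distrib, ← sum_netFlow_mul F k fun v => w (.vertex v)]
  simp only [hv]

theorem pairing_innerOn_mul (c : R) (φ : ℝ → R) (e : G.E) (F : G.Divisor) :
    pairing (innerOn e fun t => c * φ t) F = c * pairing (innerOn e φ) F := by
  rw [← pairing_mul_left]
  congr 2
  funext x
  cases x <;> simp [innerOn]

theorem pairing_innerOn_const (c : R) (e : G.E) (F : G.Divisor) :
    pairing (innerOn e fun _ => c) F = c * edgeDeg e F := by
  simpa [intCast_edgeDeg] using pairing_innerOn_mul c (fun _ => 1) e F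

theorem deg_eq_sum [Fintype G.V] (F : G.Divisor) :
    deg F = ∑ v, F (.vertex v) + ∑ e, edgeDeg e F := by
  rw [← pairing_const_one, pairing_eq_sum]
  simp [edgeDeg]

end MetricGraph

namespace ChainLengths

open MetricGraph

variable {g : ℕ} (L : ChainLengths g)

/-! ### The chain of loops -/

/-- The bridge from `w_j` to `v_{j+1}`. -/
def bridge (j : Fin (g + 1)) : L.graph.E := (Sum.inl j : Fin (g + 1) ⊕ (Fin g ⊕ Fin g))

/-- The top edge of the loop from `v_{k+1}` to `w_{k+1}`. -/
def top (k : Fin g) : L.graph.E := (Sum.inr (Sum.inl k) : Fin (g + 1) ⊕ (Fin g ⊕ Fin g))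

/-- The bottom edge of the loop from `v_{k+1}` to `w_{k+1}`. -/
def bot (k : Fin g) : L.graph.E := (Sum.inr (Sum.inr k) : Fin (g + 1) ⊕ (Fin g ⊕ Fin g))

/-- The source of the bridge `j`. -/
def bridgeSrc (j : Fin (g + 1)) : L.graph.V := (Sum.inl j : Fin (g + 1) ⊕ Fin (g + 1))

/-- The target of the bridge `j`. -/
def bridgeTgt (j : Fin (g + 1)) : L.graph.V := (Sum.inr j : Fin (g + 1) ⊕ Fin (g + 1))

instance : Fintype L.graph.V := inferInstanceAs (Fintype (Fin (g + 1) ⊕ Fin (g + 1)))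

@[simp] theorem src_bridge (j : Fin (g + 1)) : L.graph.src (L.bridge j) = L.bridgeSrc j := rfl
@[simp] theorem tgt_bridge (j : Fin (g + 1)) : L.graph.tgt (L.bridge j) = L.bridgeTgt j := rfl
@[simp] theorem src_top (k : Fin g) : L.graph.src (L.top k) = L.bridgeTgt k.castSucc := rfl
@[simp] theorem tgt_top (k : Fin g) : L.graph.tgt (L.top k) = L.bridgeSrc k.succ := rfl
@[simp] theorem src_bot (k : Fin g) : L.graph.src (L.bot k) = L.bridgeTgt k.castSucc := rfl
@[simp] theorem tgt_bot (k : Fin g) : L.graph.tgt (L.bot k) = L.bridgeSrc k.succ := rfl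
@[simp] theorem len_bridge (j : Fin (g + 1)) : L.graph.len (L.bridge j) = L.n j := rfl
@[simp] theorem len_top (k : Fin g) : L.graph.len (L.top k) = L.ℓ (k + 1) := rfl
@[simp] theorem len_bot (k : Fin g) : L.graph.len (L.bot k) = L.m (k + 1) := rfl

@[simp] theorem bridgeSrc_inj {i j : Fin (g + 1)} : L.bridgeSrc i = L.bridgeSrc j ↔ i = j :=
  Sum.inl_injective.eq_iff

@[simp] theorem bridgeTgt_inj {i j : Fin (g + 1)} : L.bridgeTgt i = L.bridgeTgt j ↔ i = j :=
  Sum.inr_injective.eq_iff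

@[simp] theorem bridgeSrc_ne_bridgeTgt (i j : Fin (g + 1)) : L.bridgeSrc i ≠ L.bridgeTgt j :=
  Sum.inl_ne_inr

@[simp] theorem bridgeTgt_ne_bridgeSrc (i j : Fin (g + 1)) : L.bridgeTgt i ≠ L.bridgeSrc j :=
  Sum.inr_ne_inl

theorem forall_vertex {p : L.graph.V → Prop} :
    (∀ v, p v) ↔ (∀ j, p (L.bridgeSrc j)) ∧ ∀ j, p (L.bridgeTgt j) :=
  Sum.forall

theorem forall_edge {p : L.graph.E → Prop} :
    (∀ e, p e) ↔ (∀ j, p (L.bridge j)) ∧ (∀ k, p (L.top k)) ∧ ∀ k, p (L.bot k) :=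
  Sum.forall.trans (and_congr Iff.rfl Sum.forall)

theorem sum_vertices {M : Type*} [AddCommMonoid M] (f : L.graph.V → M) :
    ∑ v, f v = ∑ j, f (L.bridgeSrc j) + ∑ j, f (L.bridgeTgt j) :=
  Fintype.sum_sum_type f

theorem sum_edges {M : Type*} [AddCommMonoid M] (f : L.graph.E → M) :
    ∑ e, f e = ∑ j, f (L.bridge j) + (∑ k, f (L.top k) + ∑ k, f (L.bot k)) :=
  (Fintype.sum_sum_type f).trans
    (congrArg _ (Fintype.sum_sum_type (fun x : Fin g ⊕ Fin g => f (Sum.inr x))))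

section NetFlow

variable {L} (F : L.graph.Divisor) (k : L.graph.E → ℤ)

theorem netFlow_bridgeSrc_zero : netFlow F k (L.bridgeSrc 0) = - k (L.bridge 0) := by
  simp [netFlow, sum_edges, Fin.succ_ne_zero]

theorem netFlow_bridgeSrc_succ (i : Fin g) : netFlow F k (L.bridgeSrc i.succ) =
    (k (L.top i) - edgeDeg (L.top i) F) + (k (L.bot i) - edgeDeg (L.bot i) F)
      - k (L.bridge i.succ) := by
  simp [netFlow, sum_edges]

theorem netFlow_bridgeTgt_castSucc (i : Fin g) : netFlow F k (L.bridgeTgt i.castSucc) =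
    k (L.bridge i.castSucc) - edgeDeg (L.bridge i.castSucc) F - k (L.top i) - k (L.bot i) := by
  simp [netFlow, sum_edges]
  ring

theorem netFlow_bridgeTgt_last : netFlow F k (L.bridgeTgt (Fin.last g)) =
    k (L.bridge (Fin.last g)) - edgeDeg (L.bridge (Fin.last g)) F := by
  simp [netFlow, sum_edges, Fin.castSucc_ne_last]

end NetFlow

/-- A flow on the chain of loops that is compatible with the loops comes from a function. -/
theorem exists_isDiv {F : L.graph.Divisor} {k : L.graph.E → ℤ}
    (hv : ∀ v, F (.vertex v) = netFlow F k v)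
    (hl : ∀ i, rise F k (L.top i) = rise F k (L.bot i)) :
    ∃ (f : L.graph.Point → ℝ) (P : Fin (g + 1) → ℝ), IsDiv f F ∧ P 0 = 0 ∧
      (∀ i : Fin g, P i.succ =
        P i.castSucc + rise F k (L.bridge i.castSucc) + rise F k (L.bot i)) ∧
      ∀ j : Fin (g + 1), ∀ t ∈ Set.Icc 0 (L.n j),
        f (onEdge (L.bridge j) t) = P j + k (L.bridge j) * t - bend F (L.bridge j) t := by
  let P : Fin (g + 1) → ℝ := Fin.induction (motive := fun _ => ℝ) 0
    fun i x => x + rise F k (L.bridge i.castSucc) + rise F k (L.bot i)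
  have hP : ∀ i : Fin g, P i.succ =
      P i.castSucc + rise F k (L.bridge i.castSucc) + rise F k (L.bot i) :=
    fun i => Fin.induction_succ ..
  obtain ⟨f, hf, hf'⟩ := MetricGraph.exists_isDiv F k
    (Sum.elim P fun j => P j + rise F k (L.bridge j)) (by
      rw [forall_edge]
      refine ⟨fun j => rfl, fun i => ?_, fun i => ?_⟩
      · rw [hl]
        exact hP i
      · exact hP i) hv
  exact ⟨f, P, hf, rfl, hP, fun j => hf' (L.bridge j)⟩

/-! ### The Abel-Jacobi map -/

/-- The position of a point along the chain: `2 j` on the bridge `j` and `2 k + 1` in the interior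
of an edge of the loop `k`. -/
def level : L.graph.Point → ℕ
  | .vertex v => 2 * Sum.elim Fin.val Fin.val v
  | .inner e _ _ _ => Sum.elim (fun j : Fin (g + 1) => 2 * j.val)
      (Sum.elim (fun k : Fin g => 2 * k.val + 1) (fun k : Fin g => 2 * k.val + 1)) e

/-- The coordinate on a loop in which the bottom edge is traversed forwards and the top edge
backwards. -/
def coord : L.graph.Point → ℝ
  | .vertex _ => 0
  | .inner e t _ _ => Sum.elim (fun _ : Fin (g + 1) => 0)
      (Sum.elim (fun _ : Fin g => -t) (fun _ : Fin g => t)) e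

/-- The retraction of the chain onto the loop `k`, in the coordinate `coord`. -/
def pos (k : Fin g) (x : L.graph.Point) : ℝ :=
  if L.level x < 2 * k + 1 then 0 else if 2 * k + 1 < L.level x then L.m (k + 1) else L.coord x

@[simp] theorem level_bridgeSrc (j : Fin (g + 1)) : L.level (.vertex (L.bridgeSrc j)) = 2 * j := rfl
@[simp] theorem level_bridgeTgt (j : Fin (g + 1)) : L.level (.vertex (L.bridgeTgt j)) = 2 * j := rfl
@[simp] theorem level_inner_bridge (j : Fin (g + 1)) (t : ℝ) (h0 : 0 < t)
    (h1 : t < L.graph.len (L.bridge j)) : L.level (.inner (L.bridge j) t h0 h1) = 2 * j := rfl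
@[simp] theorem level_inner_top (k : Fin g) (t : ℝ) (h0 : 0 < t)
    (h1 : t < L.graph.len (L.top k)) : L.level (.inner (L.top k) t h0 h1) = 2 * k + 1 := rfl
@[simp] theorem level_inner_bot (k : Fin g) (t : ℝ) (h0 : 0 < t)
    (h1 : t < L.graph.len (L.bot k)) : L.level (.inner (L.bot k) t h0 h1) = 2 * k + 1 := rfl
@[simp] theorem coord_inner_top (k : Fin g) (t : ℝ) (h0 : 0 < t)
    (h1 : t < L.graph.len (L.top k)) : L.coord (.inner (L.top k) t h0 h1) = -t := rfl
@[simp] theorem coord_inner_bot (k : Fin g) (t : ℝ) (h0 : 0 < t)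
    (h1 : t < L.graph.len (L.bot k)) : L.coord (.inner (L.bot k) t h0 h1) = t := rfl

theorem pos_of_level_lt {k : Fin g} {x : L.graph.Point} (h : L.level x < 2 * k + 1) :
    L.pos k x = 0 := if_pos h

theorem pos_of_lt_level {k : Fin g} {x : L.graph.Point} (h : 2 * k + 1 < L.level x) :
    L.pos k x = L.m (k + 1) := by
  rw [pos, if_neg h.not_gt, if_pos h]

theorem pos_of_level_eq {k : Fin g} {x : L.graph.Point} (h : L.level x = 2 * k + 1) :
    L.pos k x = L.coord x := by
  rw [pos, if_neg h.not_lt, if_neg h.not_gt]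

theorem pos_eq_of_level_eq {k : Fin g} {x y : L.graph.Point} (h : L.level x = L.level y)
    (hx : L.level x ≠ 2 * k + 1) : L.pos k x = L.pos k y := by
  rcases lt_or_gt_of_ne hx with h' | h'
  · rw [L.pos_of_level_lt h', L.pos_of_level_lt (h ▸ h')]
  · rw [L.pos_of_lt_level h', L.pos_of_lt_level (h ▸ h')]

/-- The necessity half of Abel's theorem for one loop. `pos k` is constant on every edge off the
loop k, so summation by parts leaves only its top and bottom edges. When the two rises agree, the
pairing is an integer multiple of the circumference, and the integer is the slope with which the top
edge arrives at its target. -/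
theorem pairing_pos_eq {F : L.graph.Divisor} {s : L.graph.E → ℤ}
    (hv : ∀ v, F (.vertex v) = netFlow F s v) (k : Fin g) :
    pairing (L.pos k) F = (s (L.top k) - edgeDeg (L.top k) F : ℤ) * (L.ℓ (k + 1) + L.m (k + 1))
      + rise F s (L.bot k) - rise F s (L.top k) := by
  have hconst : ∀ (e : L.graph.E) (c : ℝ), L.pos k (.vertex (L.graph.src e)) = c →
      L.pos k (.vertex (L.graph.tgt e)) = c →
      (∀ t h0 h1, L.pos k (.inner e t h0 h1) = c) →
      ((s e - edgeDeg e F : ℤ) : ℝ) * L.pos k (.vertex (L.graph.tgt e))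
      - s e * L.pos k (.vertex (L.graph.src e))
      + pairing (innerOn e fun t => L.pos k (onEdge e t)) F = 0 := by
    intro e c h1 h2 h3
    rw [innerOn_congr (χ := fun _ => c) (fun t h0 h1 => by rw [onEdge_inner e h0 h1, h3]),
      pairing_innerOn_const, h1, h2]
    push_cast
    ring
  have hside : ∀ (e : L.graph.E) (i : Fin g), i ≠ k →
      L.graph.src e = L.bridgeTgt i.castSucc → L.graph.tgt e = L.bridgeSrc i.succ →
      (∀ t h0 h1, L.level (.inner e t h0 h1) = 2 * i + 1) →
      ((s e - edgeDeg e F : ℤ) : ℝ) * L.pos k (.vertex (L.graph.tgt e))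
      - s e * L.pos k (.vertex (L.graph.src e))
      + pairing (innerOn e fun t => L.pos k (onEdge e t)) F = 0 := by
    intro e i hi h1 h2 h3
    rcases lt_or_gt_of_ne (Fin.val_ne_of_ne hi) with h | h
    · refine hconst e 0 ?_ ?_ fun t h0 h1 => ?_
      · rw [h1]; exact L.pos_of_level_lt (by simp; omega)
      · rw [h2]; exact L.pos_of_level_lt (by simp; omega)
      · exact L.pos_of_level_lt (by rw [h3]; omega)
    · refine hconst e (L.m (k + 1)) ?_ ?_ fun t h0 h1 => ?_
      · rw [h1]; exact L.pos_of_lt_level (by simp; omega)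
      · rw [h2]; exact L.pos_of_lt_level (by simp; omega)
      · exact L.pos_of_lt_level (by rw [h3]; omega)
  have hsrc : L.pos k (.vertex (L.bridgeTgt k.castSucc)) = 0 := L.pos_of_level_lt (by simp)
  have htgt : L.pos k (.vertex (L.bridgeSrc k.succ)) = L.m (k + 1) :=
    L.pos_of_lt_level (by simp; omega)
  rw [pairing_eq_sum_edges (L.pos k) hv, sum_edges, Finset.sum_eq_zero, Finset.sum_eq_single k,
    Finset.sum_eq_single k]
  · rw [innerOn_congr (χ := fun t => -1 * t) (fun t h0 h1 => by
        rw [onEdge_inner _ h0 h1, L.pos_of_level_eq (by simp), coord_inner_top]; ring),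
      innerOn_congr (e := L.bot k) (χ := fun t => t) (fun t h0 h1 => by
        rw [onEdge_inner _ h0 h1, L.pos_of_level_eq (by simp), coord_inner_bot])]
    rw [pairing_innerOn_mul]
    simp only [src_top, tgt_top, src_bot, tgt_bot, hsrc, htgt, rise, edgeMoment, len_top, len_bot]
    ring
  · exact fun i _ hi => hside _ i hi rfl rfl fun _ _ _ => rfl
  · simp
  · exact fun i _ hi => hside _ i hi rfl rfl fun _ _ _ => rfl
  · simp
  · intro j _
    refine hconst _ _ rfl ?_ fun t h0 h1 => ?_
    · exact L.pos_eq_of_level_eq rfl (by simp; omega)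
    · exact L.pos_eq_of_level_eq rfl (by simp; omega)

theorem deg_eq_zero {F : L.graph.Divisor} {s : L.graph.E → ℤ}
    (hv : ∀ v, F (.vertex v) = netFlow F s v) : deg F = 0 := by
  rw [← pairing_const_one, pairing_eq_sum_edges _ hv]
  refine Finset.sum_eq_zero fun e _ => ?_
  rw [pairing_innerOn_const]
  simp

/-- Two divisors on a chain of loops are equivalent if and only if they have the same degree and
the same image in the Jacobian, which is the product of the loops. -/
theorem linEquiv_iff (D D' : L.graph.Divisor) : LinEquiv D D' ↔ deg D' = deg D ∧
    ∀ k : Fin g, ∃ z : ℤ,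
      pairing (L.pos k) D' = pairing (L.pos k) D + z * (L.ℓ (k + 1) + L.m (k + 1)) := by
  have hdeg : deg D' = deg D ↔ deg (D' - D) = 0 := by
    rw [← pairing_const_one, ← pairing_const_one, ← pairing_const_one, map_sub, sub_eq_zero]
  rw [hdeg]
  constructor
  · rintro ⟨f, hf⟩
    obtain ⟨s, hs, hv⟩ := (isDiv_iff f _).1 hf
    refine ⟨L.deg_eq_zero hv, fun k => ⟨s (L.top k) - edgeDeg (L.top k) (D' - D), ?_⟩⟩
    have h := L.pairing_pos_eq hv k
    rw [rise_eq_sub hs, rise_eq_sub hs, map_sub] at h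
    simp only [tgt_top, tgt_bot, src_top, src_bot] at h
    linarith
  · rintro ⟨hd, hz⟩
    choose z hz using hz
    set F := D' - D with hF
    -- Conservation at the vertices forces the flow on the bridges, from left to right: it starts
    -- with minus the coefficient at w_0 and loses every chip that is passed.
    let κ : Fin (g + 1) → ℤ := Fin.induction (motive := fun _ => ℤ) (-F (.vertex (L.bridgeSrc 0)))
      fun i x => x - edgeDeg (L.bridge i.castSucc) F - F (.vertex (L.bridgeTgt i.castSucc))
        - edgeDeg (L.top i) F - edgeDeg (L.bot i) F - F (.vertex (L.bridgeSrc i.succ))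
    have hκ : ∀ i : Fin g, κ i.succ = κ i.castSucc - edgeDeg (L.bridge i.castSucc) F
        - F (.vertex (L.bridgeTgt i.castSucc)) - edgeDeg (L.top i) F - edgeDeg (L.bot i) F
        - F (.vertex (L.bridgeSrc i.succ)) := fun i => Fin.induction_succ ..
    -- The top edge is to arrive at its target with slope z i, as `pairing_pos_eq` requires; the
    -- bottom edge carries the rest of the flow.
    let s : L.graph.E → ℤ := Sum.elim κ (Sum.elim (fun i => z i + edgeDeg (L.top i) F)
      fun i => κ i.castSucc - edgeDeg (L.bridge i.castSucc) F
        - F (.vertex (L.bridgeTgt i.castSucc)) - (z i + edgeDeg (L.top i) F))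
    have s1 : ∀ j, s (L.bridge j) = κ j := fun j => rfl
    have s2 : ∀ i, s (L.top i) = z i + edgeDeg (L.top i) F := fun i => rfl
    have s3 : ∀ i, s (L.bot i) = κ i.castSucc - edgeDeg (L.bridge i.castSucc) F
        - F (.vertex (L.bridgeTgt i.castSucc)) - (z i + edgeDeg (L.top i) F) := fun i => rfl
    have hsrc : ∀ j, F (.vertex (L.bridgeSrc j)) = netFlow F s (L.bridgeSrc j) := by
      intro j
      refine Fin.cases ?_ (fun i => ?_) j
      · rw [netFlow_bridgeSrc_zero, s1]
        simp [κ]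
      · rw [netFlow_bridgeSrc_succ, s1, s2, s3, hκ]
        ring
    have htgt : ∀ i : Fin g, F (.vertex (L.bridgeTgt i.castSucc))
        = netFlow F s (L.bridgeTgt i.castSucc) := by
      intro i
      rw [netFlow_bridgeTgt_castSucc, s1, s2, s3]
      ring
    -- The equation at the last vertex is where degree zero enters: the net flows and the chips
    -- inside edges cancel in total.
    have hlast : F (.vertex (L.bridgeTgt (Fin.last g)))
        = netFlow F s (L.bridgeTgt (Fin.last g)) := by
      have h1 := sum_netFlow_mul F s fun _ => (1 : ℤ)
      rw [deg_eq_sum] at hd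
      simp only [mul_one, Int.cast_id, sub_right_comm _ (edgeDeg _ F), sub_self, zero_sub,
        Finset.sum_neg_distrib] at h1
      rw [sum_vertices, Fin.sum_univ_castSucc (fun j => netFlow F s (L.bridgeTgt j)),
        ← Finset.sum_congr rfl fun j _ => hsrc j, ← Finset.sum_congr rfl fun j _ => htgt j] at h1
      rw [sum_vertices, Fin.sum_univ_castSucc (fun j => F (.vertex (L.bridgeTgt j)))] at hd
      linarith
    have hv : ∀ v, F (.vertex v) = netFlow F s v := by
      rw [forall_vertex]
      exact ⟨hsrc, fun j => Fin.lastCases hlast htgt j⟩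
    obtain ⟨f, P, hf, -⟩ := L.exists_isDiv hv fun i => by
      have h := L.pairing_pos_eq hv i
      have h2 := hz i
      rw [s2, add_sub_cancel_right] at h
      rw [hF, map_sub] at h
      linarith
    exact ⟨f, hf⟩

end ChainLengths

/-! ### Superposition of flows, the canonical divisor and the divisors D_i. -/

namespace MetricGraph

variable {G : MetricGraph}

theorem rise_add (F F' : G.Divisor) (k k' : G.E → ℤ) (e : G.E) :
    rise (F + F') (k + k') e = rise F k e + rise F' k' e := by
  simp only [rise, map_add, Pi.add_apply]
  push_cast
  ring

theorem netFlow_add (F F' : G.Divisor) (k k' : G.E → ℤ) (v : G.V) :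
    netFlow (F + F') (k + k') v = netFlow F k v + netFlow F' k' v := by
  simp only [netFlow, map_add, Pi.add_apply, ← Finset.sum_add_distrib]
  refine Finset.sum_congr rfl fun e _ => ?_
  split_ifs <;> ring

theorem rise_multiset_sum {ι : Type*} (F : ι → G.Divisor) (s : ι → G.E → ℤ) (I : Multiset ι)
    (e : G.E) : rise (I.map F).sum (I.map s).sum e = (I.map fun i => rise (F i) (s i) e).sum := by
  induction I using Multiset.induction_on with
  | empty => simp [rise]
  | cons i I ih => simp only [Multiset.map_cons, Multiset.sum_cons, rise_add, ih]

end MetricGraph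

namespace ChainLengths

open MetricGraph

/-- The initial slopes on the edges of a function with divisor `F`. -/
structure IsFlow {g : ℕ} (L : ChainLengths g) (F : L.graph.Divisor) (s : L.graph.E → ℤ) : Prop where
  vertex : ∀ v, F (.vertex v) = netFlow F s v
  loop : ∀ k, rise F s (L.top k) = rise F s (L.bot k)

theorem IsFlow.add {g : ℕ} {L : ChainLengths g} {F F' : L.graph.Divisor} {s s' : L.graph.E → ℤ}
    (h : L.IsFlow F s) (h' : L.IsFlow F' s') : L.IsFlow (F + F') (s + s') where
  vertex v := by rw [netFlow_add, ← h.vertex, ← h'.vertex, Finsupp.add_apply]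
  loop k := by rw [rise_add, rise_add, h.loop, h'.loop]

theorem isFlow_zero {g : ℕ} (L : ChainLengths g) : L.IsFlow 0 0 where
  vertex v := by simp [netFlow]
  loop k := by simp [rise]

theorem isFlow_multiset_sum {g : ℕ} {L : ChainLengths g} {ι : Type*} {F : ι → L.graph.Divisor}
    {s : ι → L.graph.E → ℤ} (h : ∀ i, L.IsFlow (F i) (s i)) (I : Multiset ι) :
    L.IsFlow (I.map F).sum (I.map s).sum := by
  induction I using Multiset.induction_on with
  | empty => simpa using L.isFlow_zero
  | cons i I ih => simpa using (h i).add ih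

theorem pos_leftEnd {g : ℕ} (L : ChainLengths g) (k : Fin g) : L.pos k L.leftEnd = 0 :=
  L.pos_of_level_lt (x := .vertex (L.bridgeSrc 0)) (by simp)

theorem pos_rightEnd {g : ℕ} (L : ChainLengths g) (k : Fin g) :
    L.pos k L.rightEnd = L.m (k + 1) :=
  L.pos_of_lt_level (x := .vertex (L.bridgeTgt (Fin.last g))) (by simp; omega)

/-- The canonical divisor. -/
def canonical {g : ℕ} (L : ChainLengths g) : L.graph.Divisor :=
  ∑ k : Fin g, (Finsupp.single (.vertex (L.bridgeTgt k.castSucc)) 1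
    + Finsupp.single (.vertex (L.bridgeSrc k.succ)) 1)
    - Finsupp.single L.leftEnd 1 - Finsupp.single L.rightEnd 1

theorem pairing_canonical {g : ℕ} (L : ChainLengths g) {R : Type*} [CommRing R]
    (w : L.graph.Point → R) : pairing w L.canonical =
      ∑ k : Fin g, (w (.vertex (L.bridgeTgt k.castSucc)) + w (.vertex (L.bridgeSrc k.succ)))
        - w L.leftEnd - w L.rightEnd := by
  simp [canonical]

theorem canonical_bridgeSrc_zero {g : ℕ} (L : ChainLengths g) :
    L.canonical (.vertex (L.bridgeSrc 0)) = -1 := by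
  have h1 : L.leftEnd = .vertex (L.bridgeSrc 0) := rfl
  have h2 : L.rightEnd = .vertex (L.bridgeTgt (Fin.last g)) := rfl
  classical
  simp [canonical, h1, h2, Fin.succ_ne_zero]

theorem canonical_bridgeSrc_succ {g : ℕ} (L : ChainLengths g) (k : Fin g) :
    L.canonical (.vertex (L.bridgeSrc k.succ)) = 1 := by
  have h1 : L.leftEnd = .vertex (L.bridgeSrc 0) := rfl
  have h2 : L.rightEnd = .vertex (L.bridgeTgt (Fin.last g)) := rfl
  classical
  simp [canonical, h1, h2, Finsupp.single_apply]

theorem canonical_bridgeTgt_castSucc {g : ℕ} (L : ChainLengths g) (k : Fin g) :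
    L.canonical (.vertex (L.bridgeTgt k.castSucc)) = 1 := by
  have h1 : L.leftEnd = .vertex (L.bridgeSrc 0) := rfl
  have h2 : L.rightEnd = .vertex (L.bridgeTgt (Fin.last g)) := rfl
  classical
  simp [canonical, h1, h2, Finsupp.single_apply]

theorem canonical_bridgeTgt_last {g : ℕ} (L : ChainLengths g) :
    L.canonical (.vertex (L.bridgeTgt (Fin.last g))) = -1 := by
  have h1 : L.leftEnd = .vertex (L.bridgeSrc 0) := rfl
  have h2 : L.rightEnd = .vertex (L.bridgeTgt (Fin.last g)) := rfl
  classical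
  simp [canonical, h1, h2, Fin.castSucc_ne_last]

theorem deg_canonical {g : ℕ} (L : ChainLengths g) : deg L.canonical = 2 * g - 2 := by
  rw [← pairing_const_one, pairing_canonical]
  simp
  ring

/-- Each of the g - 1 - k loops to the right contributes two chips; the chip at the right vertex of
the loop itself cancels against the -1 at the right end. -/
theorem pairing_pos_canonical {g : ℕ} (L : ChainLengths g) (k : Fin g) :
    pairing (L.pos k) L.canonical = 2 * ((g : ℝ) - 1 - k) * L.m (k + 1) := by
  have h1 : ∀ i : Fin g, L.pos k (.vertex (L.bridgeTgt i.castSucc))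
      = if k < i then L.m (k + 1) else 0 := by
    intro i
    split_ifs with h
    · exact L.pos_of_lt_level (by simp; omega)
    · exact L.pos_of_level_lt (by simp; omega)
  have h2 : ∀ i : Fin g, L.pos k (.vertex (L.bridgeSrc i.succ))
      = if k ≤ i then L.m (k + 1) else 0 := by
    intro i
    split_ifs with h
    · exact L.pos_of_lt_level (by simp; omega)
    · exact L.pos_of_level_lt (by simp; omega)
  have h3 : (k : ℕ) < g := k.isLt
  simp only [pairing_canonical, pos_leftEnd, pos_rightEnd, h1, h2, Finset.sum_add_distrib,
    ← Finset.sum_filter, Finset.sum_const, nsmul_eq_mul]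
  rw [Finset.filter_lt_eq_Ioi, Finset.filter_le_eq_Ici, Fin.card_Ioi, Fin.card_Ici,
    Nat.cast_sub h3.le, Nat.cast_sub (by omega), Nat.cast_sub (by omega)]
  push_cast
  ring

variable {r : ℕ} (L : ChainLengths (r + 1))

/-- The hypothesis on the edge lengths of the loops. -/
def LongTops : Prop := ∀ k : Fin (r + 1), 4 * ((r : ℝ) + 1) * L.m (k + 1) < L.ℓ (k + 1)

/-- The position on its top edge of the chip on the loop `k` of the `i`-th divisor. -/
def chipPos (i k : Fin (r + 1)) : ℝ :=
  if k < i then L.ℓ (k + 1) - ((i : ℝ) - k) * L.m (k + 1) else ((k : ℝ) - i) * L.m (k + 1)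

/-- The chip on the loop `k` of the `i`-th divisor. -/
def chip (i k : Fin (r + 1)) : L.graph.Point := onEdge (L.top k) (L.chipPos i k)

/-- The divisor equivalent to the canonical divisor with multiplicity `i` at the left end and
`r - i` at the right end. -/
def endsRep (i : Fin (r + 1)) : L.graph.Divisor :=
  L.endsDivisor r i + ∑ k ∈ Finset.univ.erase i, Finsupp.single (L.chip i k) 1

/-- The slopes of the function with divisor `endsRep i - canonical`. -/
def endsSlope (i : Fin (r + 1)) : L.graph.E → ℤ :=
  Sum.elim (fun j : Fin (r + 1 + 1) => (j : ℤ) - 1 - i + if (i : ℕ) < j then 1 else 0)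
    (Sum.elim (fun k : Fin (r + 1) => if k ≤ i then 0 else 1)
      (fun k : Fin (r + 1) => (k : ℤ) - i))

theorem endsSlope_bridge (i : Fin (r + 1)) (j : Fin (r + 1 + 1)) :
    L.endsSlope i (L.bridge j) = (j : ℤ) - 1 - i + if (i : ℕ) < j then 1 else 0 := rfl
theorem endsSlope_top (i k : Fin (r + 1)) :
    L.endsSlope i (L.top k) = if k ≤ i then 0 else 1 := rfl
theorem endsSlope_bot (i k : Fin (r + 1)) : L.endsSlope i (L.bot k) = (k : ℤ) - i := rfl

theorem bridge_ne_top {g : ℕ} (L : ChainLengths g) (j : Fin (g + 1)) (k : Fin g) :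
    L.top k ≠ L.bridge j := Sum.inr_ne_inl

theorem top_ne_bot {g : ℕ} (L : ChainLengths g) (j : Fin g) (k : Fin g) :
    L.top k ≠ L.bot j := fun h => Sum.inl_ne_inr (Sum.inr_injective h)

theorem top_inj {g : ℕ} (L : ChainLengths g) {j k : Fin g} : L.top j = L.top k ↔ j = k :=
  (Sum.inr_injective.comp Sum.inl_injective).eq_iff

variable {L}

/-- The chip lies at a distance of between 1 and r bottom lengths from one end of the top edge, and
the top edge is longer than that. -/
theorem chip_eq (hL : L.LongTops) {i k : Fin (r + 1)} (hk : k ≠ i) :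
    ∃ h0 h1, L.chip i k = .inner (L.top k) (L.chipPos i k) h0 h1 := by
  have hm : 0 < L.m (k + 1) := L.m_pos _ (by omega) (by omega)
  have hl := hL k
  have hi : ((i : ℕ) : ℝ) ≤ r := by exact_mod_cast Nat.le_of_lt_succ i.isLt
  have hk' : ((k : ℕ) : ℝ) ≤ r := by exact_mod_cast Nat.le_of_lt_succ k.isLt
  have hi0 : (0 : ℝ) ≤ (i : ℕ) := Nat.cast_nonneg _
  have hk0 : (0 : ℝ) ≤ (k : ℕ) := Nat.cast_nonneg _
  have h : 0 < L.chipPos i k ∧ L.chipPos i k < L.graph.len (L.top k) := by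
    rw [len_top, chipPos]
    split_ifs with h
    · have h' : ((k : ℕ) : ℝ) < (i : ℕ) := by exact_mod_cast h
      constructor <;> nlinarith
    · have h' : ((i : ℕ) : ℝ) < (k : ℕ) := by
        exact_mod_cast lt_of_le_of_ne (not_lt.1 h) hk.symm
      constructor
      · exact mul_pos (by linarith) hm
      · nlinarith
  exact ⟨h.1, h.2, onEdge_inner _ h.1 h.2⟩

theorem level_chip (hL : L.LongTops) {i k : Fin (r + 1)} (hk : k ≠ i) :
    L.level (L.chip i k) = 2 * k + 1 := by
  obtain ⟨h0, h1, h⟩ := chip_eq hL hk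
  rw [h, level_inner_top]

theorem pairing_endsDivisor {g : ℕ} (L : ChainLengths g) {R : Type*} [CommRing R]
    (w : L.graph.Point → R) (r i : ℕ) :
    pairing w (L.endsDivisor r i) = i * w L.leftEnd + ((r : R) - i) * w L.rightEnd := by
  simp [endsDivisor, sub_mul]

theorem pairing_endsRep {R : Type*} [CommRing R] (w : L.graph.Point → R) (i : Fin (r + 1)) :
    pairing w (L.endsRep i) = i * w L.leftEnd + ((r : R) - i) * w L.rightEnd
      + ∑ k ∈ Finset.univ.erase i, w (L.chip i k) := by
  simp [endsRep, pairing_endsDivisor]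

open Classical in
theorem pairing_innerOn_endsRep_sub (hL : L.LongTops) (i : Fin (r + 1)) {R : Type*} [CommRing R]
    (e : L.graph.E) (φ : ℝ → R) : pairing (innerOn e φ) (L.endsRep i - L.canonical) =
      ∑ k ∈ Finset.univ.erase i, if L.top k = e then φ (L.chipPos i k) else 0 := by
  rw [map_sub, pairing_endsRep, pairing_canonical]
  simp only [leftEnd, rightEnd, innerOn, mul_zero, add_zero, zero_add, Finset.sum_const_zero,
    sub_zero]
  refine Finset.sum_congr rfl fun k hk => ?_
  obtain ⟨h0, h1, h⟩ := chip_eq hL (Finset.ne_of_mem_erase hk)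
  rw [h]

theorem pairing_innerOn_bridge (hL : L.LongTops) (i : Fin (r + 1)) {R : Type*} [CommRing R]
    (j : Fin (r + 1 + 1)) (φ : ℝ → R) :
    pairing (innerOn (L.bridge j) φ) (L.endsRep i - L.canonical) = 0 := by
  rw [pairing_innerOn_endsRep_sub hL]
  exact Finset.sum_eq_zero fun k _ => if_neg (L.bridge_ne_top j k)

theorem pairing_innerOn_bot (hL : L.LongTops) (i : Fin (r + 1)) {R : Type*} [CommRing R]
    (j : Fin (r + 1)) (φ : ℝ → R) :
    pairing (innerOn (L.bot j) φ) (L.endsRep i - L.canonical) = 0 := by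
  rw [pairing_innerOn_endsRep_sub hL]
  exact Finset.sum_eq_zero fun k _ => if_neg (L.top_ne_bot j k)

theorem pairing_innerOn_top (hL : L.LongTops) (i : Fin (r + 1)) {R : Type*} [CommRing R]
    (j : Fin (r + 1)) (φ : ℝ → R) :
    pairing (innerOn (L.top j) φ) (L.endsRep i - L.canonical)
      = if j = i then 0 else φ (L.chipPos i j) := by
  rw [pairing_innerOn_endsRep_sub hL]
  simp only [top_inj]
  by_cases h : j = i
  · subst h
    simp
  · simp [h]

theorem endsRep_vertex (hL : L.LongTops) (i : Fin (r + 1)) (v : L.graph.V) :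
    L.endsRep i (.vertex v) = L.endsDivisor r i (.vertex v) := by
  rw [endsRep, Finsupp.add_apply, Finsupp.finsetSum_apply, Finset.sum_eq_zero, add_zero]
  intro k hk
  obtain ⟨h0, h1, h⟩ := chip_eq hL (Finset.ne_of_mem_erase hk)
  classical
  rw [h, Finsupp.single_apply, if_neg (by simp)]

theorem endsDivisor_bridgeSrc {g : ℕ} (L : ChainLengths g) (r i : ℕ) (j : Fin (g + 1)) :
    L.endsDivisor r i (.vertex (L.bridgeSrc j)) = if j = 0 then (i : ℤ) else 0 := by
  have h1 : L.leftEnd = .vertex (L.bridgeSrc 0) := rfl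
  have h2 : L.rightEnd = .vertex (L.bridgeTgt (Fin.last g)) := rfl
  classical
  simp [endsDivisor, h1, h2, Finsupp.single_apply, eq_comm]

theorem endsDivisor_bridgeTgt {g : ℕ} (L : ChainLengths g) (r i : ℕ) (j : Fin (g + 1)) :
    L.endsDivisor r i (.vertex (L.bridgeTgt j)) = if j = Fin.last g then (r : ℤ) - i else 0 := by
  have h1 : L.leftEnd = .vertex (L.bridgeSrc 0) := rfl
  have h2 : L.rightEnd = .vertex (L.bridgeTgt (Fin.last g)) := rfl
  classical
  simp only [endsDivisor, h1, h2, Finsupp.add_apply, Finsupp.single_apply, Point.vertex.injEq,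
    bridgeTgt_inj, eq_comm, bridgeTgt_ne_bridgeSrc, if_false, zero_add]

/-- The positions `chipPos` solve the loop condition. The bottom edge of loop k has slope k - i. For
k < i the top edge has slope 0 before the chip and -1 after it, and for k > i slope 1 before and 0
after; the chip is where both edges rise by (k - i) times the bottom length. On loop i both edges
are flat, so no chip is needed. -/
theorem isFlow_endsRep (hL : L.LongTops) (i : Fin (r + 1)) :
    L.IsFlow (L.endsRep i - L.canonical) (L.endsSlope i) where
  vertex := by
    have e1 := fun j => pairing_innerOn_bridge (R := ℤ) hL i j fun _ => 1
    have e2 := fun j => pairing_innerOn_top (R := ℤ) hL i j fun _ => 1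
    have e3 := fun j => pairing_innerOn_bot (R := ℤ) hL i j fun _ => 1
    rw [forall_vertex]
    refine ⟨fun j => ?_, fun j => ?_⟩
    · rw [Finsupp.sub_apply, endsRep_vertex hL, endsDivisor_bridgeSrc]
      refine Fin.cases ?_ (fun k => ?_) j
      · rw [canonical_bridgeSrc_zero, netFlow_bridgeSrc_zero, endsSlope_bridge]
        simp
      · rw [canonical_bridgeSrc_succ, netFlow_bridgeSrc_succ, endsSlope_bridge, endsSlope_top,
          endsSlope_bot, edgeDeg, edgeDeg, e2, e3]
        rcases lt_trichotomy k i with h | h | h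
        · have h' : ¬ ((i : ℕ) < k + 1) := by omega
          simp [h.le, h.ne, h', Fin.succ_ne_zero]
        · subst h
          simp [Fin.succ_ne_zero]
        · have h' : (i : ℕ) < k + 1 := by omega
          simp [h.not_ge, h.ne', h', Fin.succ_ne_zero]
    · rw [Finsupp.sub_apply, endsRep_vertex hL, endsDivisor_bridgeTgt]
      refine Fin.lastCases ?_ (fun k => ?_) j
      · have h' : (i : ℕ) < r + 1 := i.isLt
        rw [canonical_bridgeTgt_last, netFlow_bridgeTgt_last, endsSlope_bridge, edgeDeg, e1]
        simp [h']
      · rw [canonical_bridgeTgt_castSucc, netFlow_bridgeTgt_castSucc, endsSlope_bridge,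
          endsSlope_top, endsSlope_bot, edgeDeg, e1]
        rcases le_or_gt k i with h | h
        · have h' : ¬ ((i : ℕ) < k) := by omega
          simp [h, h', Fin.castSucc_ne_last]
        · have h' : (i : ℕ) < k := by omega
          simp [h.not_ge, h', Fin.castSucc_ne_last]
  loop k := by
    rw [rise, rise, edgeMoment, edgeMoment, edgeDeg, edgeDeg, pairing_innerOn_top hL,
      pairing_innerOn_top hL, pairing_innerOn_bot hL, pairing_innerOn_bot hL, len_top, len_bot,
      endsSlope_top, endsSlope_bot]
    rcases lt_trichotomy k i with h | h | h
    · simp [h.le, h.ne, chipPos, h]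
      ring
    · subst h
      simp
    · simp [h.not_ge, h.ne', h.not_gt, chipPos]

theorem linEquiv_endsRep (hL : L.LongTops) (i : Fin (r + 1)) :
    LinEquiv L.canonical (L.endsRep i) := by
  obtain ⟨f, _, hf, _⟩ := L.exists_isDiv (isFlow_endsRep hL i).vertex (isFlow_endsRep hL i).loop
  exact ⟨f, hf⟩

theorem isEndsRep_endsRep (hL : L.LongTops) (i : Fin (r + 1)) :
    L.IsEndsRep L.canonical r i (L.endsRep i) := by
  refine ⟨linEquiv_endsRep hL i, ?_⟩
  rw [endsRep, add_sub_cancel_left]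
  exact Finset.sum_nonneg fun k _ => Finsupp.single_nonneg.2 zero_le_one

/-- The value of the function with divisor `endsRep i - canonical` at the point `w_j`. -/
def endsValue {g : ℕ} (L : ChainLengths g) (i : ℕ) : ℕ → ℝ
  | 0 => 0
  | j + 1 => endsValue L i j + L.n j * (j - 1 - i + if i < j then 1 else 0) + L.m (j + 1) * (j - i)

/-- The functions with divisors `∑ i ∈ I, endsRep i - m • canonical`, on the bridges. -/
theorem exists_isDiv_multiset (hL : L.LongTops) (I : Multiset (Fin (r + 1))) :
    ∃ f : L.graph.Point → ℝ,
      IsDiv f ((I.map L.endsRep).sum - Multiset.card I • L.canonical) ∧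
      ∀ j : Fin (r + 1 + 1), ∀ t ∈ Set.Icc 0 (L.n j), f (onEdge (L.bridge j) t) =
        (I.map fun i : Fin (r + 1) => L.endsValue i j
          + ((j : ℝ) - 1 - i + if (i : ℕ) < j then 1 else 0) * t).sum := by
  have hI := isFlow_multiset_sum (isFlow_endsRep hL) I
  obtain ⟨f, P, hf, hP0, hP, hfP⟩ := L.exists_isDiv hI.vertex hI.loop
  have hF : (I.map fun i => L.endsRep i - L.canonical).sum
      = (I.map L.endsRep).sum - Multiset.card I • L.canonical := by
    rw [Multiset.sum_map_sub, Multiset.map_const', Multiset.sum_replicate]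
  have hrise : ∀ e, rise (I.map fun i => L.endsRep i - L.canonical).sum (I.map L.endsSlope).sum e
      = (I.map fun i => rise (L.endsRep i - L.canonical) (L.endsSlope i) e).sum := by
    exact fun e => rise_multiset_sum _ _ I e
  have hP' : ∀ j : Fin (r + 1 + 1), P j = (I.map fun i : Fin (r + 1) => L.endsValue i j).sum := by
    intro j
    induction j using Fin.induction with
    | zero => simp [hP0, endsValue]
    | succ k ih =>
      rw [hP, ih, hrise, hrise, ← Multiset.sum_map_add, ← Multiset.sum_map_add]
      congr 1
      refine Multiset.map_congr rfl fun i _ => ?_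
      rw [rise, rise, edgeMoment, edgeMoment, edgeDeg, edgeDeg, pairing_innerOn_bridge hL,
        pairing_innerOn_bridge hL, pairing_innerOn_bot hL, pairing_innerOn_bot hL,
        endsSlope_bridge, endsSlope_bot, len_bridge, len_bot]
      simp only [Fin.val_castSucc, Fin.val_succ, endsValue]
      push_cast
      ring
  refine ⟨f, hF ▸ hf, fun j t ht => ?_⟩
  have hb : bend (I.map fun i => L.endsRep i - L.canonical).sum (L.bridge j) t = 0 := by
    rw [bend, map_multiset_sum, Multiset.map_map]
    exact Multiset.sum_eq_zero fun x hx => by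
      obtain ⟨i, _, rfl⟩ := Multiset.mem_map.1 hx
      exact pairing_innerOn_bridge hL i j _
  have hs : (((I.map L.endsSlope).sum (L.bridge j) : ℤ) : ℝ) * t
      = (I.map fun i : Fin (r + 1) =>
        ((j : ℝ) - 1 - i + if (i : ℕ) < j then 1 else 0) * t).sum := by
    rw [Multiset.sum_map_mul_right]
    congr 1
    clear * -
    induction I using Multiset.induction_on with
    | empty => simp
    | cons i I ih =>
      rw [Multiset.map_cons, Multiset.sum_cons, Multiset.map_cons, Multiset.sum_cons, Pi.add_apply,
        Int.cast_add, ih, endsSlope_bridge]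
      push_cast
      rfl
  rw [hfP j t ht, hb, hs, hP', sub_zero, Multiset.sum_map_add]

end ChainLengths

/-! ### Counting chips by pairing with indicator functions. -/

namespace MetricGraph

variable {G : MetricGraph} {R : Type*} [CommRing R]

theorem pairing_congr {w w' : G.Point → R} {F : G.Divisor} (h : ∀ x, F x ≠ 0 → w x = w' x) :
    pairing w F = pairing w' F := by
  simp only [pairing_apply]
  exact Finsupp.sum_congr fun x hx => by rw [h x (Finsupp.mem_support_iff.1 hx)]

theorem pairing_nonneg {w : G.Point → ℤ} (h : ∀ x, 0 ≤ w x) {F : G.Divisor} (hF : 0 ≤ F) :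
    0 ≤ pairing w F := by
  rw [← pairing_zero_left F]
  exact pairing_mono h hF

theorem deg_sub (F F' : G.Divisor) : deg (F - F') = deg F - deg F' := by
  simp only [← pairing_const_one, map_sub]

theorem deg_single (x : G.Point) (n : ℤ) : deg (Finsupp.single x n) = n := by
  simp [deg]

theorem deg_sum_single {ι : Type*} (s : Finset ι) (x : ι → G.Point) :
    deg (∑ k ∈ s, Finsupp.single (x k) 1) = s.card := by
  rw [← pairing_const_one, map_sum]
  simp

/-- The number of chips of a divisor at the points with a given property. -/
def count (p : G.Point → Prop) [DecidablePred p] : G.Divisor →+ ℤ :=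
  pairing fun x => if p x then 1 else 0

section Count

variable {p q : G.Point → Prop} [DecidablePred p] [DecidablePred q] {F : G.Divisor}

theorem count_nonneg (hF : 0 ≤ F) : 0 ≤ count p F :=
  pairing_nonneg (fun x => by positivity) hF

theorem count_mono (h : ∀ x, p x → q x) (hF : 0 ≤ F) : count p F ≤ count q F := by
  refine pairing_mono (fun x => ?_) hF
  have := h x
  split_ifs <;> simp_all

theorem count_le_deg (hF : 0 ≤ F) : count p F ≤ deg F := by
  rw [← pairing_const_one]
  refine pairing_mono (fun x => ?_) hF
  split_ifs <;> simp

theorem count_add_count_not (F : G.Divisor) : count p F + count (fun x => ¬ p x) F = deg F := by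
  rw [← pairing_const_one, count, count, ← pairing_add_left]
  congr 2
  funext x
  split_ifs <;> simp_all

theorem eq_zero_of_count_eq_zero (hF : 0 ≤ F) (h : count p F = 0) {x : G.Point} (hx : p x) :
    F x = 0 := by
  by_contra hne
  have hs : x ∈ F.support := Finsupp.mem_support_iff.2 hne
  rw [count, pairing_apply, Finsupp.sum, Finset.sum_eq_zero_iff_of_nonneg] at h
  · have := h x hs
    simp [hx, hne] at this
  · intro y _
    have : 0 ≤ F y := hF y
    split_ifs <;> simp [this]

theorem exists_of_count_ne_zero (h : count p F ≠ 0) : ∃ x, p x ∧ F x ≠ 0 := by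
  by_contra! h'
  exact h ((pairing_congr (w' := fun _ => 0) fun x hx => if_neg fun hp => hx (h' x hp)).trans
    (pairing_zero_left F))

end Count

theorem eq_of_le_of_deg_eq {F F' : G.Divisor} (h : F ≤ F') (hd : deg F = deg F') : F = F' := by
  have h0 : 0 ≤ F' - F := sub_nonneg.2 h
  have h1 : count (fun _ : G.Point => True) (F' - F) = 0 := by
    simp [count, pairing_const_one, deg_sub, hd]
  refine (sub_eq_zero.1 (Finsupp.ext fun x => ?_)).symm
  exact eq_zero_of_count_eq_zero h0 h1 trivial

end MetricGraph

namespace ChainLengths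

open MetricGraph

variable {g : ℕ} (L : ChainLengths g)

/-! ### Counting chips on effective divisors -/

theorem sum_level_eq (s : Finset (Fin g)) (x : L.graph.Point) :
    (∑ k ∈ s, if L.level x = 2 * k + 1 then (1 : ℤ) else 0)
      ≤ if ∃ k ∈ s, L.level x = 2 * k + 1 then 1 else 0 := by
  split_ifs with h
  · obtain ⟨k, hk, hx⟩ := h
    rw [Finset.sum_eq_single_of_mem k hk, if_pos hx]
    intro b _ hb
    refine if_neg fun h => hb (Fin.ext ?_)
    omega
  · push Not at h
    exact (Finset.sum_eq_zero fun k hk => if_neg (h k hk)).le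

variable {L}

/-- If each loop in a set has a chip, then there are at least as many chips as loops. -/
theorem card_le_count {s : Finset (Fin g)} {p : L.graph.Point → Prop} [DecidablePred p]
    {F : L.graph.Divisor} (hF : 0 ≤ F) (hs : ∀ k ∈ s, count (fun x => L.level x = 2 * k + 1) F ≠ 0)
    (hp : ∀ k ∈ s, ∀ x, L.level x = 2 * k + 1 → p x) : (s.card : ℤ) ≤ count p F := by
  have h1 : (s.card : ℤ) ≤ ∑ k ∈ s, count (fun x => L.level x = 2 * k + 1) F := by
    rw [Finset.card_eq_sum_ones, Nat.cast_sum]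
    refine Finset.sum_le_sum fun k hk => ?_
    have := count_nonneg (p := fun x => L.level x = 2 * (k : ℕ) + 1) hF
    have := hs k hk
    push_cast
    omega
  refine h1.trans ?_
  simp only [count]
  rw [← pairing_sum_left]
  refine pairing_mono (fun x => (L.sum_level_eq s x).trans ?_) hF
  by_cases h : ∃ k ∈ s, L.level x = 2 * k + 1
  · obtain ⟨k, hk, hx⟩ := h
    rw [if_pos ⟨k, hk, hx⟩, if_pos (hp k hk x hx)]
  · rw [if_neg h]
    split_ifs <;> simp

/-- On a divisor with no chip on the loop `k`, the loop only sees the chips to its right. -/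
theorem pairing_pos_of_count_eq_zero {F : L.graph.Divisor} (hF : 0 ≤ F) {k : Fin g}
    (h : count (fun x => L.level x = 2 * k + 1) F = 0) :
    pairing (L.pos k) F = count (fun x => 2 * k + 1 < L.level x) F * L.m (k + 1) := by
  rw [count, intCast_pairing, mul_comm, ← pairing_mul_left]
  refine pairing_congr fun x hx => ?_
  have hne : L.level x ≠ 2 * k + 1 := fun h' => hx (eq_zero_of_count_eq_zero hF h h')
  rcases lt_or_gt_of_ne hne with h' | h'
  · simp [L.pos_of_level_lt h', h'.not_gt]
  · simp [L.pos_of_lt_level h', h']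

theorem count_left_add_right {F : L.graph.Divisor} {k : Fin g}
    (h : count (fun x => L.level x = 2 * k + 1) F = 0) :
    count (fun x => L.level x < 2 * k + 1) F + count (fun x => 2 * k + 1 < L.level x) F
      = deg F := by
  rw [← pairing_const_one, ← add_zero (_ + _), ← h]
  simp only [count]
  rw [← pairing_add_left, ← pairing_add_left]
  congr 2
  funext x
  rcases lt_trichotomy (L.level x) (2 * k + 1) with h | h | h
  · simp [h, h.ne, h.not_gt]
  · simp [h]
  · simp [h, h.ne', h.not_gt]

theorem exists_count_eq_zero {F : L.graph.Divisor} (hF : 0 ≤ F) (hd : deg F < g) :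
    ∃ k : Fin g, count (fun x => L.level x = 2 * k + 1) F = 0 := by
  by_contra! h
  have h1 := card_le_count (s := Finset.univ) (p := fun _ => True) hF (fun k _ => h k)
    fun _ _ _ _ => trivial
  have h2 := count_le_deg (p := fun _ => True) hF
  simp only [Finset.card_univ, Fintype.card_fin] at h1
  omega

theorem le_count_left {F : L.graph.Divisor} (hF : 0 ≤ F) {k : Fin g}
    (h : ∀ i < k, count (fun x => L.level x = 2 * i + 1) F ≠ 0) :
    (k : ℤ) ≤ count (fun x => L.level x < 2 * k + 1) F := by
  have := card_le_count (s := Finset.Iio k) (p := fun x => L.level x < 2 * k + 1) hF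
    (fun i hi => h i (Finset.mem_Iio.1 hi)) fun i hi x hx => by
      have : (i : ℕ) < k := Fin.lt_def.1 (Finset.mem_Iio.1 hi)
      omega
  rwa [Fin.card_Iio] at this

theorem le_count_right {F : L.graph.Divisor} (hF : 0 ≤ F) {k : Fin g}
    (h : ∀ i > k, count (fun x => L.level x = 2 * i + 1) F ≠ 0) :
    (g : ℤ) - 1 - k ≤ count (fun x => 2 * k + 1 < L.level x) F := by
  have := card_le_count (s := Finset.Ioi k) (p := fun x => 2 * k + 1 < L.level x) hF
    (fun i hi => h i (Finset.mem_Ioi.1 hi)) fun i hi x hx => by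
      have : (k : ℕ) < i := Fin.lt_def.1 (Finset.mem_Ioi.1 hi)
      omega
  rw [Fin.card_Ioi] at this
  omega

/-! ### Points on the loops -/

variable (L) in
-- A loop is its own Jacobian: after reduction of a modulo the circumference, the bottom edge
-- followed by the top edge traversed backwards sweeps out all values.
theorem exists_point_on_loop (k : Fin g) (a : ℝ) : ∃ x : L.graph.Point,
    2 * k ≤ L.level x ∧ L.level x ≤ 2 * k + 2 ∧
      ∃ z : ℤ, L.pos k x = a + z * (L.ℓ (k + 1) + L.m (k + 1)) := by
  have hm : 0 < L.m (k + 1) := L.m_pos _ (by omega) (by omega)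
  have hl : 0 < L.ℓ (k + 1) := L.ℓ_pos _ (by omega) (by omega)
  have hs : 0 < L.ℓ (k + 1) + L.m (k + 1) := by linarith
  obtain ⟨z, b, hb0, hb1, hb⟩ : ∃ (z : ℤ) (b : ℝ), 0 ≤ b ∧ b < L.ℓ (k + 1) + L.m (k + 1) ∧
      b = a + z * (L.ℓ (k + 1) + L.m (k + 1)) := by
    refine ⟨-toIcoDiv hs 0 a, toIcoMod hs 0 a, ?_, ?_, ?_⟩
    · exact (toIcoMod_mem_Ico hs 0 a).1
    · simpa using (toIcoMod_mem_Ico hs 0 a).2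
    · rw [toIcoMod]
      simp
      ring
  rcases hb0.eq_or_lt with h0 | h0
  · refine ⟨.vertex (L.bridgeTgt k.castSucc), by simp, by simp, z, ?_⟩
    rw [L.pos_of_level_lt (by simp), ← hb, h0]
  rcases lt_trichotomy b (L.m (k + 1)) with h1 | h1 | h1
  · have h1' : b < L.graph.len (L.bot k) := h1
    refine ⟨.inner (L.bot k) b h0 h1', by simp, by simp, z, ?_⟩
    rw [L.pos_of_level_eq (by simp), coord_inner_bot, hb]
  · refine ⟨.vertex (L.bridgeSrc k.succ), by simp, by simp; omega, z, ?_⟩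
    rw [L.pos_of_lt_level (by simp; omega), ← hb, h1]
  · refine ⟨.inner (L.top k) (L.ℓ (k + 1) + L.m (k + 1) - b) (by linarith)
      (by rw [len_top]; linarith), by simp, by simp, z - 1, ?_⟩
    rw [L.pos_of_level_eq (by simp), coord_inner_top, hb]
    push_cast
    ring

theorem exists_of_level_eq {k : Fin g} {x : L.graph.Point} (h : L.level x = 2 * k + 1) :
    (∃ t h0 h1, x = .inner (L.top k) t h0 h1) ∨ ∃ t h0 h1, x = .inner (L.bot k) t h0 h1 := by
  cases x with
  | vertex v =>
    revert v
    rw [forall_vertex]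
    refine ⟨fun j h => ?_, fun j h => ?_⟩
    · rw [level_bridgeSrc] at h; omega
    · rw [level_bridgeTgt] at h; omega
  | inner e t h0 h1 =>
    revert e
    rw [forall_edge]
    refine ⟨fun j h1 h => ?_, fun i h1 h => ?_, fun i h1 h => ?_⟩
    · rw [level_inner_bridge] at h; omega
    · rw [level_inner_top] at h
      obtain rfl : i = k := Fin.ext (by omega)
      exact Or.inl ⟨t, h0, h1, rfl⟩
    · rw [level_inner_bot] at h
      obtain rfl : i = k := Fin.ext (by omega)
      exact Or.inr ⟨t, h0, h1, rfl⟩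

theorem abs_lt_one_of_mul {z : ℤ} {c s : ℝ} (hs : 0 < s) (h : c = z * s) (hc : |c| < s) :
    z = 0 := by
  rw [h, abs_mul, abs_of_pos hs] at hc
  have h1 : |(z : ℝ)| < 1 := by
    by_contra! h1
    nlinarith
  exact Int.abs_lt_one_iff.1 (by exact_mod_cast h1)

/-- All coordinates in the interiors of the two edges lie between -ℓ and m, so two of them differ by
less than the circumference; their signs tell top from bottom. -/
theorem eq_of_coord_eq {k : Fin g} {x y : L.graph.Point} (hx : L.level x = 2 * k + 1)
    (hy : L.level y = 2 * k + 1) {z : ℤ}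
    (h : L.coord x = L.coord y + z * (L.ℓ (k + 1) + L.m (k + 1))) : x = y := by
  have hm : 0 < L.m (k + 1) := L.m_pos _ (by omega) (by omega)
  have hl : 0 < L.ℓ (k + 1) := L.ℓ_pos _ (by omega) (by omega)
  have h' : L.coord x - L.coord y = z * (L.ℓ (k + 1) + L.m (k + 1)) := by linarith
  have hz : |L.coord x - L.coord y| < L.ℓ (k + 1) + L.m (k + 1) → L.coord x = L.coord y := by
    intro h1
    rw [abs_lt_one_of_mul (by linarith) h' h1] at h
    simpa using h
  rcases exists_of_level_eq hx with ⟨t, h0, h1, rfl⟩ | ⟨t, h0, h1, rfl⟩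
  · have h1' : t < L.ℓ (k + 1) := h1
    rcases exists_of_level_eq hy with ⟨u, h2, h3, rfl⟩ | ⟨u, h2, h3, rfl⟩
    · have h3' : u < L.ℓ (k + 1) := h3
      simp only [coord_inner_top] at hz
      obtain rfl : t = u := neg_injective (hz (by rw [abs_lt]; constructor <;> linarith))
      rfl
    · have h3' : u < L.m (k + 1) := h3
      simp only [coord_inner_top, coord_inner_bot] at hz
      linarith [hz (by rw [abs_lt]; constructor <;> linarith)]
  · have h1' : t < L.m (k + 1) := h1
    rcases exists_of_level_eq hy with ⟨u, h2, h3, rfl⟩ | ⟨u, h2, h3, rfl⟩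
    · have h3' : u < L.ℓ (k + 1) := h3
      simp only [coord_inner_top, coord_inner_bot] at hz
      linarith [hz (by rw [abs_lt]; constructor <;> linarith)]
    · have h3' : u < L.m (k + 1) := h3
      simp only [coord_inner_bot] at hz
      obtain rfl : t = u := hz (by rw [abs_lt]; constructor <;> linarith)
      rfl

/-! ### The canonical class -/

section Canonical

variable {r : ℕ} {L : ChainLengths (r + 1)}

/-- At most 4r bottom lengths are shorter than the circumference, so a congruence between small
multiples of the bottom length is an equality. This turns conditions in the Jacobian into chip
counts. -/
theorem eq_of_mul_eq (hL : L.LongTops) {k : Fin (r + 1)} {c c' z : ℤ} (hc : |c - c'| ≤ 4 * r)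
    (h : (c : ℝ) * L.m (k + 1) = c' * L.m (k + 1) + z * (L.ℓ (k + 1) + L.m (k + 1))) :
    c = c' := by
  have hm : 0 < L.m (k + 1) := L.m_pos _ (by omega) (by omega)
  have hl := hL k
  have hr : (0 : ℝ) ≤ r := Nat.cast_nonneg r
  have h1 : ((c - c' : ℤ) : ℝ) * L.m (k + 1) = z * (L.ℓ (k + 1) + L.m (k + 1)) := by
    push_cast
    linarith
  have h2 : |((c - c' : ℤ) : ℝ)| ≤ 4 * r := by exact_mod_cast hc
  have hz : z = 0 := by
    refine abs_lt_one_of_mul (by nlinarith) h1 ?_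
    rw [abs_mul, abs_of_pos hm]
    nlinarith
  rw [hz, Int.cast_zero, zero_mul, mul_eq_zero, or_iff_left hm.ne'] at h1
  exact sub_eq_zero.1 (by exact_mod_cast h1)

theorem exists_min_empty {F : L.graph.Divisor} (hF : 0 ≤ F) (hd : deg F < (r + 1 : ℕ)) :
    ∃ k : Fin (r + 1), count (fun x => L.level x = 2 * k + 1) F = 0 ∧
      (k : ℤ) ≤ count (fun x => L.level x < 2 * k + 1) F ∧
      ∀ i : Fin (r + 1), count (fun x => L.level x = 2 * i + 1) F = 0 → k ≤ i := by
  have hne : (Finset.univ.filter fun k : Fin (r + 1) =>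
      count (fun x => L.level x = 2 * k + 1) F = 0).Nonempty := by
    obtain ⟨k, hk⟩ := exists_count_eq_zero hF hd
    exact ⟨k, by simpa using hk⟩
  refine ⟨Finset.min' _ hne, ?_, le_count_left hF fun i hi h => ?_,
    fun i hi => Finset.min'_le _ i (by simpa using hi)⟩
  · simpa using Finset.min'_mem _ hne
  · exact (Finset.min'_le _ i (by simpa using h)).not_gt hi

theorem exists_max_empty {F : L.graph.Divisor} (hF : 0 ≤ F) (hd : deg F < (r + 1 : ℕ)) :
    ∃ k : Fin (r + 1), count (fun x => L.level x = 2 * k + 1) F = 0 ∧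
      (r : ℤ) - k ≤ count (fun x => 2 * k + 1 < L.level x) F ∧
      ∀ i : Fin (r + 1), count (fun x => L.level x = 2 * i + 1) F = 0 → i ≤ k := by
  have hne : (Finset.univ.filter fun k : Fin (r + 1) =>
      count (fun x => L.level x = 2 * k + 1) F = 0).Nonempty := by
    obtain ⟨k, hk⟩ := exists_count_eq_zero hF hd
    exact ⟨k, by simpa using hk⟩
  refine ⟨Finset.max' _ hne, ?_, ?_, fun i hi => Finset.le_max' _ i (by simpa using hi)⟩
  · simpa using Finset.max'_mem _ hne
  · have := le_count_right hF (k := Finset.max' _ hne) fun i hi h =>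
      (Finset.le_max' _ i (by simpa using h)).not_gt hi
    push_cast at this
    omega

/-- The divisor to subtract is (r + 1) w_0. An effective divisor F equivalent to the rest has degree
r - 1, so some loop is empty; let k be the first one. At least k chips lie to its left, hence at
most r - 1 - k to its right, while the class demands 2 (r - k). -/
theorem not_rankAtLeast_canonical (hL : L.LongTops) : ¬ RankAtLeast L.canonical (r + 1) := by
  intro h
  obtain ⟨F, hF, hlin⟩ := h (Finsupp.single L.leftEnd (r + 1 : ℕ))
    (Finsupp.single_nonneg.2 (by positivity)) (deg_single _ _)
  obtain ⟨hd, hpos⟩ := (L.linEquiv_iff _ _).1 hlin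
  have hdeg : deg F = r - 1 := by
    rw [hd, deg_sub, deg_canonical, deg_single]
    push_cast
    ring
  obtain ⟨k, hk, hleft, -⟩ := exists_min_empty hF (by push_cast; omega)
  obtain ⟨z, hz⟩ := hpos k
  have hlr := count_left_add_right hk
  have h0 := count_nonneg (p := fun x => 2 * (k : ℕ) + 1 < L.level x) hF
  have h1 := count_le_deg (p := fun x => 2 * (k : ℕ) + 1 < L.level x) hF
  have hkr := k.isLt
  rw [pairing_pos_of_count_eq_zero hF hk, map_sub, pairing_pos_canonical, pairing_single,
    pos_leftEnd] at hz
  have := eq_of_mul_eq hL (k := k) (c := count (fun x => 2 * k + 1 < L.level x) F)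
    (c' := 2 * (r - k)) (z := z) (by rw [abs_le]; omega) (by
    rw [hz]
    push_cast
    ring)
  omega

/-- Some loop κ contains none of the r chips of E, with exactly κ of them on its left and r - κ on
its right. Put one chip on each other loop so as to solve the coordinate of that loop: the chips
elsewhere contribute only 0 or a bottom length to it, wherever they sit. The coordinate of loop κ
then holds automatically, since 2 (r - κ) from the canonical divisor minus r - κ from E is the
number of new chips on its right. -/
theorem rankAtLeast_canonical (L : ChainLengths (r + 1)) : RankAtLeast L.canonical r := by
  intro E hE hdE
  -- Level below 2 k + 2 means on loop k or to its left. Minimality of k forces equality in the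
  -- count and leaves loop k empty, a discrete intermediate value argument.
  have hex : ∃ k : ℕ, count (fun x => L.level x < 2 * k + 2) E ≤ k :=
    ⟨r, hdE ▸ count_le_deg hE⟩
  classical
  obtain ⟨k₀, hk₀, hmin⟩ : ∃ k : ℕ, count (fun x => L.level x < 2 * k + 2) E ≤ k ∧
      ∀ i < k, (i : ℤ) < count (fun x => L.level x < 2 * i + 2) E :=
    ⟨Nat.find hex, Nat.find_spec hex, fun i hi => not_le.1 (Nat.find_min hex hi)⟩
  have hk₀r : k₀ < r + 1 := by
    by_contra! h
    have := hmin r (by omega)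
    have := count_le_deg (p := fun x => L.level x < 2 * r + 2) hE
    omega
  have hleft : (k₀ : ℤ) ≤ count (fun x => L.level x < 2 * k₀) E := by
    rcases Nat.eq_zero_or_pos k₀ with rfl | h
    · simpa using count_nonneg hE
    · have h1 := hmin (k₀ - 1) (by omega)
      rw [show 2 * (k₀ - 1) + 2 = 2 * k₀ by omega] at h1
      omega
  have hmono := count_mono (p := fun x => L.level x < 2 * k₀)
    (q := fun x => L.level x < 2 * k₀ + 2) (fun x hx => by omega) hE
  have hzero : count (fun x => L.level x = 2 * k₀ + 1) E = 0 := by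
    have h1 : count (fun x => L.level x = 2 * k₀ + 1) E + count (fun x => L.level x < 2 * k₀) E
        ≤ count (fun x => L.level x < 2 * k₀ + 2) E := by
      simp only [count]
      rw [← pairing_add_left]
      refine pairing_mono (fun x => ?_) hE
      split_ifs <;> omega
    have := count_nonneg (p := fun x => L.level x = 2 * k₀ + 1) hE
    omega
  have hright : count (fun x => 2 * k₀ + 1 < L.level x) E = r - k₀ := by
    have h1 := count_add_count_not (p := fun x => L.level x < 2 * k₀ + 2) E
    have h2 : count (fun x => ¬ L.level x < 2 * k₀ + 2) E
        = count (fun x => 2 * k₀ + 1 < L.level x) E := by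
      simp only [count]
      congr 2
      funext x
      exact if_congr (by omega) rfl rfl
    omega
  obtain ⟨κ, rfl⟩ : ∃ κ : Fin (r + 1), (κ : ℕ) = k₀ := ⟨⟨k₀, hk₀r⟩, rfl⟩
  choose x hx1 hx2 z hz using fun k : Fin (r + 1) => L.exists_point_on_loop k
    (pairing (L.pos k) (L.canonical - E)
      - ∑ i ∈ (Finset.univ.erase κ).erase k, if k < i then L.m (k + 1) else 0)
  have hpos : ∀ k i : Fin (r + 1), i ≠ k →
      L.pos k (x i) = if k < i then L.m (k + 1) else 0 := by
    intro k i hik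
    have h1 := hx1 i
    have h2 := hx2 i
    split_ifs with h
    · exact L.pos_of_lt_level (by omega)
    · exact L.pos_of_level_lt (by omega)
  refine ⟨∑ k ∈ Finset.univ.erase κ, Finsupp.single (x k) 1,
    Finset.sum_nonneg fun k _ => Finsupp.single_nonneg.2 zero_le_one,
    (L.linEquiv_iff _ _).2 ⟨?_, fun k => ?_⟩⟩
  · rw [deg_sum_single, deg_sub, deg_canonical, hdE]
    simp
    ring
  · have hsum : pairing (L.pos k) (∑ i ∈ Finset.univ.erase κ, Finsupp.single (x i) 1)
        = ∑ i ∈ Finset.univ.erase κ, L.pos k (x i) := by simp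
    rw [hsum]
    by_cases hk : k = κ
    · subst hk
      refine ⟨0, ?_⟩
      rw [Finset.sum_congr rfl fun i hi => hpos k i (Finset.ne_of_mem_erase hi), map_sub,
        pairing_pos_canonical, pairing_pos_of_count_eq_zero hE hzero, hright,
        Finset.sum_erase _ (by simp), ← Finset.sum_filter, Finset.filter_lt_eq_Ioi,
        Finset.sum_const, Fin.card_Ioi, nsmul_eq_mul, Nat.cast_sub (by omega),
        Nat.cast_sub (by omega)]
      push_cast
      ring
    · refine ⟨z k, ?_⟩
      rw [← Finset.add_sum_erase _ _ (Finset.mem_erase.2 ⟨hk, Finset.mem_univ k⟩), hz,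
        Finset.sum_congr rfl fun i hi => hpos k i (Finset.ne_of_mem_erase hi)]
      ring

theorem sum_single_le {F : L.graph.Divisor} (hF : 0 ≤ F) {s : Finset (Fin (r + 1))}
    {x : Fin (r + 1) → L.graph.Point} (hx : ∀ k ∈ s, L.level (x k) = 2 * k + 1)
    (hFx : ∀ k ∈ s, F (x k) ≠ 0) : ∑ k ∈ s, Finsupp.single (x k) (1 : ℤ) ≤ F := by
  classical
  intro y
  rw [Finsupp.finsetSum_apply]
  by_cases h : ∃ k ∈ s, x k = y
  · obtain ⟨k, hk, rfl⟩ := h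
    rw [Finset.sum_eq_single_of_mem k hk, Finsupp.single_eq_same]
    · have h0 : 0 ≤ F (x k) := hF (x k)
      have := hFx k hk
      omega
    · intro i hi hik
      rw [Finsupp.single_apply, if_neg]
      intro h
      have h1 := hx i hi
      rw [h, hx k hk] at h1
      exact hik (Fin.ext (by omega))
  · push Not at h
    rw [Finset.sum_eq_zero]
    · exact hF y
    · intro k hk
      rw [Finsupp.single_apply, if_neg (h k hk)]

theorem pairing_pos_sum_single {i k : Fin (r + 1)} (hk : k ≠ i) {x : Fin (r + 1) → L.graph.Point}
    (hx : ∀ k, k ≠ i → L.level (x k) = 2 * k + 1) :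
    pairing (L.pos k) (∑ j ∈ Finset.univ.erase i, Finsupp.single (x j) 1) = L.coord (x k)
      + ∑ j ∈ (Finset.univ.erase i).erase k, if k < j then L.m (k + 1) else 0 := by
  rw [map_sum, ← Finset.add_sum_erase _ _ (Finset.mem_erase.2 ⟨hk, Finset.mem_univ k⟩)]
  congr 1
  · simp [L.pos_of_level_eq (hx k hk)]
  · refine Finset.sum_congr rfl fun j hj => ?_
    obtain ⟨hjk, hji⟩ := Finset.mem_erase.1 hj
    have h1 := hx j (Finset.ne_of_mem_erase hji)
    rw [pairing_single, Int.cast_one, one_mul]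
    split_ifs with h
    · exact L.pos_of_lt_level (by omega)
    · exact L.pos_of_level_lt (by omega)

/-- An empty loop k must have r - 2 k + i chips of F on its right. At the last empty loop at least r
- k chips lie on the right, so k ≤ i; at the first one at least k of the 2 k - i chips on the left
are accounted for, so k ≥ i. Hence every loop except i is occupied, and the r chips of F are one on
each of those loops. Their positions are then fixed by the class. -/
theorem eq_endsRep (hL : L.LongTops) (i : Fin (r + 1)) {D : L.graph.Divisor}
    (hD : L.IsEndsRep L.canonical r i D) : D = L.endsRep i := by
  obtain ⟨hlin, hF⟩ := hD
  obtain ⟨hd, hpos⟩ := (L.linEquiv_iff _ _).1 hlin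
  set F := D - L.endsDivisor r i with hFD
  have hdF : deg F = r := by
    rw [← pairing_const_one, hFD, map_sub, pairing_endsDivisor, pairing_const_one, hd,
      deg_canonical]
    push_cast
    ring
  have hi := i.isLt
  have hempty : ∀ k : Fin (r + 1), count (fun x => L.level x = 2 * k + 1) F = 0 →
      count (fun x => 2 * k + 1 < L.level x) F = r - 2 * k + i := by
    intro k hk
    obtain ⟨z, hz⟩ := hpos k
    have h0 := count_nonneg (p := fun x => 2 * (k : ℕ) + 1 < L.level x) hF
    have h1 := count_le_deg (p := fun x => 2 * (k : ℕ) + 1 < L.level x) hF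
    have h2 := pairing_pos_of_count_eq_zero hF hk
    have hkr := k.isLt
    refine eq_of_mul_eq hL (k := k) (z := z) (by rw [abs_le]; omega) ?_
    rw [← h2, hFD, map_sub, hz, pairing_pos_canonical, pairing_endsDivisor, pos_leftEnd,
      pos_rightEnd]
    push_cast
    ring
  have honly : ∀ k : Fin (r + 1), count (fun x => L.level x = 2 * k + 1) F = 0 → k ≤ i := by
    obtain ⟨k, hk, hr, hmax⟩ := exists_max_empty hF (by push_cast; omega)
    have := hempty k hk
    exact fun j hj => (hmax j hj).trans (Fin.mk_le_of_le_val (by omega))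
  have honly' : ∀ k : Fin (r + 1), k ≠ i → count (fun x => L.level x = 2 * k + 1) F ≠ 0 := by
    intro k hki hk
    obtain ⟨k', hk', hl, hmin⟩ := exists_min_empty hF (by push_cast; omega)
    have h1 := hempty k' hk'
    have h2 := count_left_add_right hk'
    have h3 : (k' : ℕ) ≤ k := hmin k hk
    have h4 : (k : ℕ) ≤ i := honly k hk
    exact hki (Fin.ext (by omega))
  have : Nonempty L.graph.Point := ⟨L.leftEnd⟩
  choose! x hx hFx using fun k hk => exists_of_count_ne_zero (honly' k hk)
  have hFsum : F = ∑ k ∈ Finset.univ.erase i, Finsupp.single (x k) 1 := by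
    refine (eq_of_le_of_deg_eq (sum_single_le hF (fun k hk => hx k (Finset.ne_of_mem_erase hk))
      fun k hk => hFx k (Finset.ne_of_mem_erase hk)) ?_).symm
    rw [hdF, deg_sum_single]
    simp
  rw [endsRep, ← sub_eq_iff_eq_add', ← hFD, hFsum]
  refine Finset.sum_congr rfl fun k hk => ?_
  have hki := Finset.ne_of_mem_erase hk
  congr 1
  obtain ⟨z, hz⟩ := hpos k
  obtain ⟨z', hz'⟩ := ((L.linEquiv_iff _ _).1 (linEquiv_endsRep hL i)).2 k
  have h1 := pairing_pos_sum_single hki hx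
  have h2 := pairing_pos_sum_single hki (x := L.chip i) fun k hk => level_chip hL hk
  rw [← hFsum, hFD, map_sub, hz] at h1
  rw [endsRep, map_add, h2] at hz'
  refine eq_of_coord_eq (hx k hki) (level_chip hL hki) (z := z - z') ?_
  push_cast
  linarith

theorem isVertexAvoiding_canonical (hL : L.LongTops) : L.IsVertexAvoiding L.canonical r := by
  refine ⟨⟨rankAtLeast_canonical L, not_rankAtLeast_canonical hL⟩, fun i hi => ?_⟩
  obtain ⟨i, rfl⟩ : ∃ i' : Fin (r + 1), (i' : ℕ) = i := ⟨⟨i, by omega⟩, rfl⟩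
  refine ⟨L.endsRep i, isEndsRep_endsRep hL i, fun D hD => eq_endsRep hL i hD, fun v => ?_⟩
  rw [Finsupp.sub_apply, endsRep_vertex hL, sub_self]

end Canonical

end ChainLengths

/-! ### A criterion for tropical independence -/

/-- A family of functions is tropically independent if, after adding constants, each of them is the
only one to attain the minimum at some point. -/
theorem not_tropicallyDependent_image {X ι κ : Type} [DecidableEq ι] {S : Finset κ}
    (hS : S.Nonempty) {I : κ → ι} {ψ : ι → X → ℝ} (c : κ → ℝ) (p : κ → X)
    (h : ∀ α ∈ S, ∀ β ∈ S, α ≠ β → ψ (I α) (p α) + c α < ψ (I β) (p α) + c β) :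
    ¬ TropicallyDependent (S.image I) ψ := by
  rintro ⟨b, hb⟩
  -- Relative to the constants c, no function is raised less by b than the one for α. Its strict
  -- minimum at p α therefore survives the change of constants.
  obtain ⟨α, hα, hmin⟩ := S.exists_min_image (fun α => b (I α) - c α) hS
  obtain ⟨i, hi, j, hj, hij, heq, hle⟩ := hb (p α)
  obtain ⟨β, hβ, rfl⟩ := Finset.mem_image.1 hi
  obtain ⟨γ, hγ, rfl⟩ := Finset.mem_image.1 hj
  have hα' := hle (I α) (Finset.mem_image_of_mem I hα)
  have key : ∀ δ ∈ S, α ≠ δ →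
      ψ (I α) (p α) + b (I α) < ψ (I δ) (p α) + b (I δ) := by
    intro δ hδ hne
    have h1 := h α hα δ hδ hne
    have h2 := hmin δ hδ
    linarith
  by_cases hβα : α = β
  · subst hβα
    exact (key γ hγ fun h => hij (h ▸ rfl)).ne heq
  · exact absurd hα' (key β hβ hβα).not_ge

theorem injOn_of_certificate {X ι κ : Type} {S : Finset κ} {I : κ → ι} {ψ : ι → X → ℝ}
    (c : κ → ℝ) (p : κ → X)
    (h : ∀ α ∈ S, ∀ β ∈ S, α ≠ β → ψ (I α) (p α) + c α < ψ (I β) (p α) + c β) :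
    Set.InjOn I S := by
  intro α hα β hβ hI
  by_contra hne
  have h1 := h α hα β hβ hne
  have h2 := h β hβ α hα (Ne.symm hne)
  rw [hI] at h1 h2
  linarith

/-! ### Interlacing families -/

/-- Functions `F a` for `lo ≤ a ≤ hi` on an interval of integers, such that the difference of `F a`
and `F (a + 1)` changes its sign exactly once, at the point `2 a`. -/
structure Interlacing (lo hi : ℕ) (F Δ : ℕ → ℕ → ℝ) : Prop where
  step : ∀ a, lo ≤ a → a < hi → ∀ u, F (a + 1) u = F a u - Δ a u
  neg : ∀ a u, lo ≤ a → a < hi → u < 2 * a → Δ a u < 0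
  zero : ∀ a, lo ≤ a → a < hi → Δ a (2 * a) = 0
  pos : ∀ a u, lo ≤ a → a < hi → 2 * a < u → u < 2 * hi → 0 < Δ a u

namespace Interlacing

variable {lo hi : ℕ} {F Δ : ℕ → ℕ → ℝ}

theorem eq_sub_sum (h : Interlacing lo hi F Δ) {E E' : ℕ} (h1 : lo ≤ E) (h2 : E ≤ E')
    (h3 : E' ≤ hi) (u : ℕ) : F E' u = F E u - ∑ a ∈ Finset.Ico E E', Δ a u := by
  induction E', h2 using Nat.le_induction with
  | base => simp
  | succ a ha ih =>
    rw [h.step a (h1.trans ha) h3, ih (by omega), Finset.sum_Ico_succ_top ha]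
    ring

/-- The bound on u says that u lies beyond all crossings 2 a with a < E'. All the differences summed
are then positive, and any single one may be kept. -/
theorem le_sub (h : Interlacing lo hi F Δ) {E E' b u : ℕ} (h1 : lo ≤ E) (h2 : E ≤ b) (h3 : b < E')
    (h4 : E' ≤ hi) (hu : 2 * E' ≤ u + 1) (hu' : u < 2 * hi) : F E' u ≤ F E u - Δ b u := by
  rw [h.eq_sub_sum h1 (h2.trans h3.le) h4]
  have := Finset.single_le_sum (f := fun a => Δ a u) (s := Finset.Ico E E') (fun a ha => by
    have := Finset.mem_Ico.1 ha
    exact (h.pos a u (by omega) (by omega) (by omega) hu').le) (Finset.mem_Ico.2 ⟨h2, h3⟩)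
  linarith

theorem sub_le (h : Interlacing lo hi F Δ) {E E' b u : ℕ} (h1 : lo ≤ E) (h2 : E ≤ b) (h3 : b < E')
    (h4 : E' ≤ hi) (hu : u < 2 * E) : F E u ≤ F E' u + Δ b u := by
  rw [h.eq_sub_sum h1 (h2.trans h3.le) h4]
  have := Finset.single_le_sum (f := fun a => -Δ a u) (s := Finset.Ico E E') (fun a ha => by
    have := Finset.mem_Ico.1 ha
    exact (neg_pos.2 (h.neg a u (by omega) (by omega) (by omega))).le) (Finset.mem_Ico.2 ⟨h2, h3⟩)
  rw [Finset.sum_neg_distrib] at this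
  linarith

/-- The step 2 E - 1 lies strictly between the crossings 2 (E - 1) and 2 E, so the values increase
in both directions away from E. -/
theorem lt_of_ne (h : Interlacing lo hi F Δ) (hlo : 1 ≤ lo) {E E' : ℕ} (hE : lo ≤ E) (hE2 : E ≤ hi)
    (hE' : lo ≤ E') (hE2' : E' ≤ hi) (hne : E ≠ E') : F E (2 * E - 1) < F E' (2 * E - 1) := by
  rcases lt_or_gt_of_ne hne with hlt | hlt
  · have := h.sub_le hE le_rfl hlt hE2' (u := 2 * E - 1) (by omega)
    linarith [h.neg E (2 * E - 1) hE (by omega) (by omega)]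
  · have := h.le_sub hE' le_rfl hlt hE2 (u := 2 * E - 1) (by omega) (by omega)
    linarith [h.pos E' (2 * E - 1) hE' (by omega) (by omega) (by omega)]

theorem le_at_crossing (h : Interlacing lo hi F Δ) {a E : ℕ} (ha : lo ≤ a) (ha' : a < hi)
    (hE : lo ≤ E) (hE2 : E ≤ hi) : F a (2 * a) ≤ F E (2 * a) := by
  rcases lt_trichotomy E a with hlt | rfl | hlt
  · have := h.le_sub hE le_rfl hlt ha'.le (u := 2 * a) (by omega) (by omega)
    linarith [h.pos E (2 * a) hE (by omega) (by omega) (by omega)]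
  · exact le_rfl
  · have h1 := h.step a ha ha' (2 * a)
    rw [h.zero a ha ha', sub_zero] at h1
    rw [← h1]
    rcases (Nat.succ_le_of_lt hlt).eq_or_lt with rfl | hlt'
    · exact le_rfl
    · have := h.sub_le (E := a + 1) (by omega) le_rfl hlt' hE2 (u := 2 * a) (by omega)
      linarith [h.neg (a + 1) (2 * a) (by omega) (by omega) (by omega)]

/-- Functions `H a` that dip below an interlacing family only near the crossing points `2 a` can be
added to the family. -/
theorem certificate (h : Interlacing lo hi F Δ) (hlo : 1 ≤ lo) {T : Finset ℕ} {H : ℕ → ℕ → ℝ}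
    (hT : ∀ a ∈ T, lo ≤ a ∧ a < hi) (hlt : ∀ a ∈ T, H a (2 * a) < F a (2 * a))
    (hgt : ∀ a ∈ T, ∀ u, 2 * lo ≤ u + 1 → u < 2 * hi → u ≠ 2 * a →
      ∃ E, lo ≤ E ∧ E ≤ hi ∧ F E u < H a u) :
    ∀ α ∈ (Finset.Icc lo hi).disjSum T, ∀ β ∈ (Finset.Icc lo hi).disjSum T, α ≠ β →
      Sum.elim F H α (Sum.elim (fun E => 2 * E - 1) (fun a => 2 * a) α)
        < Sum.elim F H β (Sum.elim (fun E => 2 * E - 1) (fun a => 2 * a) α) := by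
  rintro (E | a) hα (E' | a') hβ hne
  · have h1 := Finset.mem_Icc.1 (Finset.inl_mem_disjSum.1 hα)
    have h2 := Finset.mem_Icc.1 (Finset.inl_mem_disjSum.1 hβ)
    exact h.lt_of_ne hlo h1.1 h1.2 h2.1 h2.2 fun h => hne (h ▸ rfl)
  · have h1 := Finset.mem_Icc.1 (Finset.inl_mem_disjSum.1 hα)
    have h2 := Finset.inr_mem_disjSum.1 hβ
    obtain ⟨E', h3, h4, h5⟩ := hgt a' h2 (2 * E - 1) (by omega) (by omega) (by omega)
    refine lt_of_le_of_lt ?_ h5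
    rcases eq_or_ne E E' with rfl | hne'
    · exact le_rfl
    · exact (h.lt_of_ne hlo h1.1 h1.2 h3 h4 hne').le
  · have h1 := Finset.inr_mem_disjSum.1 hα
    have h2 := Finset.mem_Icc.1 (Finset.inl_mem_disjSum.1 hβ)
    exact (hlt a h1).trans_le (h.le_at_crossing (hT a h1).1 (hT a h1).2 h2.1 h2.2)
  · have h1 := Finset.inr_mem_disjSum.1 hα
    have h2 := Finset.inr_mem_disjSum.1 hβ
    have h3 := hT a h1
    obtain ⟨E', h4, h5, h6⟩ := hgt a' h2 (2 * a) (by omega) (by omega) fun h => hne (by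
      rw [show a = a' by omega])
    exact (hlt a h1).trans ((h.le_at_crossing h3.1 h3.2 h4 h5).trans_lt h6)

end Interlacing

/-! ### Walking along the bridges -/

/-- The part of the `l`-th bridge, of length `n l`, that is covered after `u` steps, if each bridge
takes `2 m` steps. -/
def covered (n : ℕ → ℝ) (m l u : ℕ) : ℝ := n l * max 0 (min 1 ((u : ℝ) / (2 * m) - l))

section Covered

variable {n : ℕ → ℝ} {m l u : ℕ}

theorem covered_of_le (hm : 0 < m) (h : u ≤ 2 * (l * m)) : covered n m l u = 0 := by
  have hm' : (0 : ℝ) < 2 * m := by positivity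
  have h' : (u : ℝ) ≤ 2 * (l * m) := by exact_mod_cast h
  have h1 : (u : ℝ) / (2 * m) - l ≤ 0 := by
    rw [sub_nonpos, div_le_iff₀ hm']
    linarith
  rw [covered, max_eq_left ((min_le_right _ _).trans h1), mul_zero]

theorem covered_of_ge (hm : 0 < m) (h : 2 * ((l + 1) * m) ≤ u) : covered n m l u = n l := by
  have hm' : (0 : ℝ) < 2 * m := by positivity
  have h' : 2 * (((l : ℝ) + 1) * m) ≤ u := by exact_mod_cast h
  have h1 : 1 ≤ (u : ℝ) / (2 * m) - l := by
    rw [le_sub_iff_add_le, le_div_iff₀ hm']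
    linarith
  rw [covered, min_eq_left h1, max_eq_right zero_le_one, mul_one]

theorem covered_eq (hm : 0 < m) (h1 : 2 * (l * m) ≤ u) (h2 : u ≤ 2 * ((l + 1) * m)) :
    covered n m l u = n l * ((u : ℝ) / (2 * m) - l) := by
  have hm' : (0 : ℝ) < 2 * m := by positivity
  have h1' : 2 * ((l : ℝ) * m) ≤ u := by exact_mod_cast h1
  have h2' : (u : ℝ) ≤ 2 * ((l + 1) * m) := by exact_mod_cast h2
  rw [covered, min_eq_right, max_eq_right]
  · rw [sub_nonneg, le_div_iff₀ hm']
    linarith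
  · rw [sub_le_iff_le_add', div_le_iff₀ hm']
    linarith

theorem covered_mono (hn : 0 ≤ n l) : Monotone (covered n m l) := by
  intro u v h
  rw [covered, covered]
  gcongr

theorem covered_succ_sub (hm : 0 < m) (l u : ℕ) :
    covered n m l (u + 1) - covered n m l u = if l = u / (2 * m) then n l / (2 * m) else 0 := by
  have hdiv := Nat.div_add_mod u (2 * m)
  have hmod := Nat.mod_lt u (show 0 < 2 * m by omega)
  rcases lt_trichotomy l (u / (2 * m)) with h | h | h
  · have h1 : 2 * ((l + 1) * m) ≤ u := by
      calc 2 * ((l + 1) * m) = 2 * m * (l + 1) := by ring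
        _ ≤ 2 * m * (u / (2 * m)) := Nat.mul_le_mul_left _ h
        _ ≤ u := by omega
    rw [covered_of_ge hm h1, covered_of_ge hm (by omega), if_neg h.ne, sub_self]
  · have h1 : 2 * (l * m) ≤ u := by
      calc 2 * (l * m) = 2 * m * (u / (2 * m)) := by rw [h]; ring
        _ ≤ u := by omega
    have h2 : u + 1 ≤ 2 * ((l + 1) * m) := by
      calc u + 1 ≤ 2 * m * (u / (2 * m)) + 2 * m := by omega
        _ = 2 * ((l + 1) * m) := by rw [h]; ring
    rw [covered_eq hm (by omega) h2, covered_eq hm h1 (by omega), if_pos h]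
    push_cast
    ring
  · have h1 : u + 1 ≤ 2 * (l * m) := by
      calc u + 1 ≤ 2 * m * (u / (2 * m)) + 2 * m := by omega
        _ = 2 * m * (u / (2 * m) + 1) := by ring
        _ ≤ 2 * m * l := Nat.mul_le_mul_left _ h
        _ = 2 * (l * m) := by ring
    rw [covered_of_le hm h1, covered_of_le hm (by omega), if_neg h.ne', sub_self]

end Covered

/-! ### The interlacing family on the chain -/

/-- The setting for the family: `φ i` are functions on the integers for which the differences
`φ (i - 1) - φ i` increase everywhere, and faster on the bridge `i`. -/
structure BridgeWalk (n : ℕ → ℝ) (m r : ℕ) (X : ℕ → ℝ) (φ : ℕ → ℕ → ℝ) : Prop where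
  pos : 0 < m
  len_pos : ∀ l ≤ r, 0 < n l
  covered_le : ∀ l ≤ r, ∀ u v, u ≤ v → v < 2 * ((r + 1) * m) →
    covered n m l v - covered n m l u ≤ X v - X u
  sub_succ : ∀ i < r, ∀ u, φ i u - φ (i + 1) u = X u + covered n m (i + 1) u

namespace BridgeWalk

variable {n : ℕ → ℝ} {m r : ℕ} {X : ℕ → ℝ} {φ : ℕ → ℕ → ℝ}

variable (n m X) in
/-- The difference of two consecutive functions of the interlacing family. -/
def gap (a u : ℕ) : ℝ :=
  X u + covered n m (a / m) u - (X (2 * a) + covered n m (a / m) (2 * a))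

variable (n m X) in
/-- The constants added to the functions in the interlacing family. -/
def shift (E : ℕ) : ℝ := ∑ a ∈ Finset.Ico m E, (X (2 * a) + covered n m (a / m) (2 * a))

variable (m) in
/-- The multiset of size `m` that increases in one element at a time, from `(0, …, 0)` at `E = m`
to `(r, …, r)` at `E = (r + 1) m`. -/
def window (E : ℕ) : Multiset ℕ := (Finset.Ico (E - m) E).val.map (· / m)

variable (n m X φ) in
/-- The interlacing family. -/
def mono (E u : ℕ) : ℝ := ((window m E).map (φ · u)).sum + shift n m X E

theorem window_sum (E : ℕ) (f : ℕ → ℝ) :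
    ((window m E).map f).sum = ∑ a ∈ Finset.Ico (E - m) E, f (a / m) := by
  rw [window, Multiset.map_map]
  rfl

theorem card_window {E : ℕ} (h : m ≤ E) : Multiset.card (window m E) = m := by
  simp [window, Nat.sub_sub_self h]

theorem le_of_mem_window {E k : ℕ} (hm : 0 < m) (h : E ≤ (r + 1) * m) (hk : k ∈ window m E) :
    k ≤ r := by
  obtain ⟨a, ha, rfl⟩ := Multiset.mem_map.1 hk
  have := Finset.mem_Ico.1 (Finset.mem_def.2 ha)
  exact Nat.le_of_lt_succ ((Nat.div_lt_iff_lt_mul hm).2 (this.2.trans_le h))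

theorem div_sub_self (hm : 0 < m) {a : ℕ} (h : m ≤ a) : (a - m) / m + 1 = a / m := by
  conv_rhs => rw [← Nat.sub_add_cancel h, Nat.add_div_right _ hm]

/-- Moving the window from a to a + 1 exchanges (a - m) / m = a / m - 1 for a / m. By `sub_succ` the
two functions differ by X plus the covered part of bridge a / m, which is strictly increasing along
the walk; `shift` makes the difference vanish at 2 a. -/
theorem interlacing (h : BridgeWalk n m r X φ) :
    Interlacing m ((r + 1) * m) (mono n m X φ) (gap n m X) := by
  have hdiv : ∀ a, a < (r + 1) * m → a / m ≤ r := fun a ha =>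
    Nat.le_of_lt_succ ((Nat.div_lt_iff_lt_mul h.pos).2 ha)
  have hsucc : ∀ l ≤ r, ∀ u, l = u / (2 * m) → covered n m l u < covered n m l (u + 1) := by
    intro l hl u hu
    have := covered_succ_sub (n := n) h.pos l u
    rw [if_pos hu] at this
    have h1 : 0 < n l / (2 * m) := by
      have := h.len_pos l hl
      have := h.pos
      positivity
    linarith
  have hX : ∀ u v, u < v → v < 2 * ((r + 1) * m) → X u < X v := by
    intro u v huv hv
    have hl : u / (2 * m) ≤ r := by
      have := h.pos
      refine Nat.le_of_lt_succ ((Nat.div_lt_iff_lt_mul (by omega)).2 ?_)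
      calc u < 2 * ((r + 1) * m) := huv.trans hv
        _ = (r + 1) * (2 * m) := by ring
    have h1 := hsucc _ hl u rfl
    have h2 := covered_mono (n := n) (m := m) (h.len_pos _ hl).le (Nat.succ_le_of_lt huv)
    have h3 := h.covered_le _ hl u v huv.le hv
    simp only [Nat.succ_eq_add_one] at h2
    linarith
  refine ⟨fun a ha ha' u => ?_, fun a u ha ha' hu => ?_, fun a _ _ => sub_self _,
    fun a u ha ha' hu hu' => ?_⟩
  · have h1 : a / m = (a - m) / m + 1 := (div_sub_self h.pos ha).symm
    have h2 := h.sub_succ ((a - m) / m) (by have := hdiv a ha'; omega) u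
    rw [← h1] at h2
    have h3 : ∑ b ∈ Finset.Ico (a - m) (a + 1), φ (b / m) u
        = ∑ b ∈ Finset.Ico (a - m) a, φ (b / m) u + φ (a / m) u :=
      Finset.sum_Ico_succ_top (by omega) _
    have h4 : ∑ b ∈ Finset.Ico (a - m) (a + 1), φ (b / m) u
        = φ ((a - m) / m) u + ∑ b ∈ Finset.Ico (a - m + 1) (a + 1), φ (b / m) u :=
      Finset.sum_eq_sum_Ico_succ_bot (by omega) _
    rw [mono, mono, window_sum, window_sum, show a + 1 - m = a - m + 1 by omega, shift,
      Finset.sum_Ico_succ_top ha, ← shift, gap]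
    linarith
  · rw [gap]
    have h1 := hX u (2 * a) hu (by omega)
    have h2 := covered_mono (n := n) (m := m) (h.len_pos _ (hdiv a ha')).le hu.le
    linarith
  · rw [gap]
    have h1 := hX (2 * a) u hu hu'
    have h2 := covered_mono (n := n) (m := m) (h.len_pos _ (hdiv a ha')).le hu.le
    linarith

/-- A function that dips below the family at the crossing point `2 a`, obtained with the help of a
function with a kink at the end of the current bridge. -/
def dipRight (n : ℕ → ℝ) (m : ℕ) (X : ℕ → ℝ) (φ : ℕ → ℕ → ℝ) (a u : ℕ) : ℝ :=
  mono n m X φ (a + 1) u + (covered n m (a / m) u - covered n m (a / m + 1) u)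
    - (covered n m (a / m) (2 * a) + n (a / m) / (4 * m))

/-- A function that dips below the family at the crossing point `2 a`, obtained with the help of a
function with a kink at the start of the current bridge. -/
def dipLeft (n : ℕ → ℝ) (m : ℕ) (X : ℕ → ℝ) (φ : ℕ → ℕ → ℝ) (a u : ℕ) : ℝ :=
  mono n m X φ a u + (covered n m (a / m - 1) u - covered n m (a / m) u)
    - (n (a / m - 1) - covered n m (a / m) (2 * a) + n (a / m) / (4 * m))

/-! ### The additional functions: below the family at one crossing, above its minimum at all other
steps. -/

section Dip

variable {a : ℕ}

/-- When m does not divide a, the crossing 2 a is interior to its bridge, and the steps on both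
sides of it cover the same length. The constant n / (4 m) in the dips is half of this length. -/
theorem covered_steps (hm : 0 < m) (hq : a % m ≠ 0) :
    covered n m (a / m) (2 * a) - covered n m (a / m) (2 * a - 1) = n (a / m) / (2 * m) ∧
    covered n m (a / m) (2 * a + 1) - covered n m (a / m) (2 * a) = n (a / m) / (2 * m) := by
  have h0 := Nat.div_add_mod a m
  have h1 := Nat.mod_lt a hm
  have h2 : a / m = (2 * a - 1) / (2 * m) := by
    symm
    rw [Nat.div_eq_iff (by omega)]
    have : a / m * (2 * m) = 2 * (m * (a / m)) := by ring
    rw [this]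
    omega
  have h3 : a / m = 2 * a / (2 * m) := (Nat.mul_div_mul_left a m two_pos).symm
  constructor
  · have := covered_succ_sub (n := n) hm (a / m) (2 * a - 1)
    rwa [if_pos h2, show 2 * a - 1 + 1 = 2 * a by
      have : a ≠ 0 := by rintro rfl; simp at hq
      omega] at this
  · have := covered_succ_sub (n := n) hm (a / m) (2 * a)
    rwa [if_pos h3] at this

theorem div_bounds (hm : 0 < m) (hq : a % m ≠ 0) : a / m * m < a ∧ a < (a / m + 1) * m := by
  have h0 := Nat.div_add_mod a m
  have h1 := Nat.mod_lt a hm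
  rw [mul_comm] at h0
  constructor
  · omega
  · rw [add_mul, one_mul]
    omega

theorem dipRight_lt (h : BridgeWalk n m r X φ) (ha : m ≤ a) (ha' : a < (r + 1) * m)
    (hq : a % m ≠ 0) (hr : a / m < r) :
    dipRight n m X φ a (2 * a) < mono n m X φ a (2 * a) := by
  have h1 := h.interlacing.step a ha ha' (2 * a)
  rw [h.interlacing.zero a ha ha'] at h1
  have hb := (div_bounds h.pos hq).2
  have h2 : covered n m (a / m + 1) (2 * a) = 0 := covered_of_le h.pos (by omega)
  have h3 : 0 < n (a / m) / (4 * m) := by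
    have := h.len_pos _ hr.le
    have := h.pos
    positivity
  rw [dipRight, h1, h2]
  linarith

theorem dipLeft_lt (h : BridgeWalk n m r X φ) (ha : m ≤ a) (ha' : a < (r + 1) * m)
    (hq : a % m ≠ 0) : dipLeft n m X φ a (2 * a) < mono n m X φ a (2 * a) := by
  have hb := (div_bounds h.pos hq).1
  have hr : a / m ≤ r := Nat.le_of_lt_succ ((Nat.div_lt_iff_lt_mul h.pos).2 ha')
  have hj : 1 ≤ a / m := (Nat.one_le_div_iff h.pos).2 ha
  have h2 : covered n m (a / m - 1) (2 * a) = n (a / m - 1) :=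
    covered_of_ge h.pos (by rw [Nat.sub_add_cancel hj]; omega)
  have h3 : 0 < n (a / m) / (4 * m) := by
    have := h.len_pos _ hr
    have := h.pos
    positivity
  rw [dipLeft, h2]
  linarith

/-- Write j = a / m. To the left of 2 a, the function is `mono a` plus X (2 a) - X u minus half a
step, and X drops by at least a full step. To the right of 2 a on bridge j, it has gained at least a
full step over `mono (a + 1)`. -/
theorem exists_lt_dipRight (h : BridgeWalk n m r X φ) (ha : m ≤ a) (ha' : a < (r + 1) * m)
    (hq : a % m ≠ 0) (hr : a / m < r) {u : ℕ} (hu : u < 2 * ((r + 1) * m)) (hne : u ≠ 2 * a) :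
    ∃ E, m ≤ E ∧ E ≤ (r + 1) * m ∧ mono n m X φ E u < dipRight n m X φ a u := by
  obtain ⟨hb1, hb2⟩ := div_bounds h.pos hq
  obtain ⟨hs1, hs2⟩ := covered_steps (n := n) h.pos hq
  have hI := h.interlacing
  have hn := h.len_pos _ hr.le
  have hmono := covered_mono (n := n) (m := m) hn.le
  have hε : n (a / m) / (4 * m) < n (a / m) / (2 * m) := by
    have := h.pos
    gcongr
    norm_num
  rcases lt_or_gt_of_ne hne with hlt | hgt
  · refine ⟨a, ha, ha'.le, ?_⟩
    have h1 := hI.step a ha ha' u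
    have h2 : covered n m (a / m + 1) u = 0 := covered_of_le h.pos (by omega)
    have h3 := h.covered_le _ hr.le u (2 * a) hlt.le (by omega)
    have h4 := hmono (show u ≤ 2 * a - 1 by omega)
    have h5 := h.covered_le _ hr.le (2 * a - 1) (2 * a) (by omega) (by omega)
    rw [dipRight, h1, h2, gap]
    linarith
  · have h4 := hmono (show 2 * a + 1 ≤ u by omega)
    rcases le_or_gt u (2 * ((a / m + 1) * m)) with hle | hlt
    · refine ⟨a + 1, by omega, ha', ?_⟩
      rw [dipRight, covered_of_le h.pos hle]
      linarith
    -- Past bridge j the correction loses the covered part of bridge j + 1. The family loses at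
    -- least as much: the crossing at the start of that bridge switches to `mono (b + 1)`, whose gap
    -- includes the same covered part.
    · set b := (a / m + 1) * m with hb
      have hbr : b < (r + 1) * m := Nat.mul_lt_mul_of_pos_right (by omega) h.pos
      refine ⟨b + 1, by omega, hbr, ?_⟩
      have h5 := hI.le_sub (E := a + 1) (E' := b + 1) (b := b) (u := u) (by omega) hb2 (by omega)
        hbr (by omega) hu
      have hbm : b / m = a / m + 1 := Nat.mul_div_cancel _ h.pos
      have h6 : covered n m (a / m + 1) (2 * b) = 0 := covered_of_le h.pos le_rfl
      have h7 := h.covered_le _ hr.le (2 * b) u hlt.le hu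
      have h8 := hmono hlt.le
      rw [gap, hbm, h6] at h5
      rw [dipRight]
      linarith

/-- The mirror image of `exists_lt_dipRight`, with `mono a` as reference on the left part of bridge
a / m and `mono (a + 1)` to the right of 2 a. -/
theorem exists_lt_dipLeft (h : BridgeWalk n m r X φ) (ha : m ≤ a) (ha' : a < (r + 1) * m)
    (hq : a % m ≠ 0) {u : ℕ} (hu : u < 2 * ((r + 1) * m)) (hne : u ≠ 2 * a) :
    ∃ E, m ≤ E ∧ E ≤ (r + 1) * m ∧ mono n m X φ E u < dipLeft n m X φ a u := by
  obtain ⟨hb1, hb2⟩ := div_bounds h.pos hq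
  obtain ⟨hs1, hs2⟩ := covered_steps (n := n) h.pos hq
  have hI := h.interlacing
  have hr : a / m ≤ r := Nat.le_of_lt_succ ((Nat.div_lt_iff_lt_mul h.pos).2 ha')
  have hj : 1 ≤ a / m := (Nat.one_le_div_iff h.pos).2 ha
  have hn := h.len_pos _ hr
  have hmono := covered_mono (n := n) (m := m) hn.le
  have hε : n (a / m) / (4 * m) < n (a / m) / (2 * m) := by
    have := h.pos
    gcongr
    norm_num
  have hprev : ∀ v, 2 * (a / m * m) ≤ v → covered n m (a / m - 1) v = n (a / m - 1) := by
    intro v hv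
    exact covered_of_ge h.pos (by rwa [Nat.sub_add_cancel hj])
  rcases lt_or_gt_of_ne hne with hlt | hgt
  · rcases le_or_gt (2 * (a / m * m)) u with hle | hlt'
    · refine ⟨a, ha, ha'.le, ?_⟩
      have h4 := hmono (show u ≤ 2 * a - 1 by omega)
      rw [dipLeft, hprev u hle]
      linarith
    -- Before the bridge of 2 a the correction falls short by the uncovered part of the previous
    -- bridge. This is at most X (2 b) - X u, which is the amount by which `mono b` lies below its
    -- successor.
    · set b := a / m * m with hb
      have hmb : m ≤ b := Nat.le_mul_of_pos_left m hj
      refine ⟨b, hmb, by omega, ?_⟩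
      have h5 := hI.sub_le (E := b) (E' := a) (b := b) (u := u) hmb le_rfl hb1 ha'.le hlt'
      have hbm : b / m = a / m := Nat.mul_div_cancel _ h.pos
      have h6 : covered n m (a / m) (2 * b) = 0 := covered_of_le h.pos le_rfl
      have h7 : covered n m (a / m) u = 0 := covered_of_le h.pos hlt'.le
      have h8 := h.covered_le (a / m - 1) (by omega) u (2 * b) hlt'.le (by omega)
      rw [hprev _ le_rfl] at h8
      have h9 := hmono (show 2 * b ≤ 2 * a - 1 by omega)
      rw [gap, hbm, h6, h7] at h5
      rw [dipLeft, h7]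
      linarith
  · refine ⟨a + 1, by omega, ha', ?_⟩
    have h1 := hI.step a ha ha' u
    have h3 := h.covered_le _ hr (2 * a) u hgt.le hu
    have h4 := hmono (show 2 * a + 1 ≤ u by omega)
    rw [dipLeft, h1, gap, hprev u (by omega)]
    linarith

end Dip

/-- The crossing points at which the family is enlarged. -/
def dips (m r : ℕ) : Finset ℕ :=
  (Finset.Ico m ((r + 1) * m)).filter fun a => a % m ≠ 0 ∧ (a / m = r → a % m + 1 < m)

theorem mem_dips {a : ℕ} : a ∈ dips m r ↔
    (m ≤ a ∧ a < (r + 1) * m) ∧ a % m ≠ 0 ∧ (a / m = r → a % m + 1 < m) := by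
  simp [dips]

/-- Of the r m crossings, only the r multiples of m and the last one, (r + 1) m - 1, are excluded.
For m = 1 these overlap, hence the inequality. -/
theorem le_card_dips (hm : 0 < m) (r : ℕ) : r * m ≤ (dips m r).card + (r + 1) := by
  have h1 : (Finset.Ico m ((r + 1) * m)) ⊆
      dips m r ∪ ((Finset.Icc 1 r).image (· * m) ∪ {(r + 1) * m - 1}) := by
    intro a ha
    have ha' := Finset.mem_Ico.1 ha
    simp only [Finset.mem_union, mem_dips, Finset.mem_image, Finset.mem_Icc, Finset.mem_singleton]
    have h0 := Nat.div_add_mod' a m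
    have h1 := Nat.mod_lt a hm
    by_cases h2 : a % m = 0
    · right; left
      refine ⟨a / m, ⟨(Nat.one_le_div_iff hm).2 ha'.1,
        Nat.le_of_lt_succ ((Nat.div_lt_iff_lt_mul hm).2 ha'.2)⟩, by omega⟩
    · by_cases h3 : a / m = r → a % m + 1 < m
      · exact Or.inl ⟨ha', h2, h3⟩
      · right; right
        push Not at h3
        rw [h3.1] at h0
        rw [add_mul, one_mul]
        omega
  have h2 := Finset.card_le_card h1
  have h3 := Finset.card_union_le (dips m r) ((Finset.Icc 1 r).image (· * m) ∪ {(r + 1) * m - 1})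
  have h4 := Finset.card_union_le ((Finset.Icc 1 r).image (· * m)) {(r + 1) * m - 1}
  have h5 := Finset.card_image_le (s := Finset.Icc 1 r) (f := (· * m))
  simp only [Nat.card_Ico, Nat.card_Icc, Finset.card_singleton] at h2 h4 h5
  rw [add_mul, one_mul] at h2 h3 h4
  omega

/-- The functions that are added to the interlacing family. -/
def dip (n : ℕ → ℝ) (m r : ℕ) (X : ℕ → ℝ) (φ : ℕ → ℕ → ℝ) (a : ℕ) : ℕ → ℝ :=
  if a / m = r then dipLeft n m X φ a else dipRight n m X φ a

theorem certificate (h : BridgeWalk n m r X φ) :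
    ∀ α ∈ (Finset.Icc m ((r + 1) * m)).disjSum (dips m r),
    ∀ β ∈ (Finset.Icc m ((r + 1) * m)).disjSum (dips m r), α ≠ β →
      Sum.elim (mono n m X φ) (dip n m r X φ) α
          (Sum.elim (fun E => 2 * E - 1) (fun a => 2 * a) α)
        < Sum.elim (mono n m X φ) (dip n m r X φ) β
          (Sum.elim (fun E => 2 * E - 1) (fun a => 2 * a) α) := by
  have hdiv : ∀ a, a < (r + 1) * m → a / m ≤ r := fun a ha =>
    Nat.le_of_lt_succ ((Nat.div_lt_iff_lt_mul h.pos).2 ha)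
  refine h.interlacing.certificate h.pos (fun a ha => (mem_dips.1 ha).1) (fun a ha => ?_)
    fun a ha u _ hu hne => ?_
  all_goals
    obtain ⟨⟨h1, h2⟩, h3, -⟩ := mem_dips.1 ha
    rw [dip]
    split_ifs with hr
  · exact h.dipLeft_lt h1 h2 h3
  · exact h.dipRight_lt h1 h2 h3 (lt_of_le_of_ne (hdiv a h2) hr)
  · exact h.exists_lt_dipLeft h1 h2 h3 hu hne
  · exact h.exists_lt_dipRight h1 h2 h3 (lt_of_le_of_ne (hdiv a h2) hr) hu hne

/-- The multisets of the functions that are added to the family. -/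
def dipMultiset (m r a : ℕ) : Multiset ℕ :=
  if a / m = r then (a / m - 2) ::ₘ (a / m) ::ₘ (Finset.Ico (a - m + 2) a).val.map (· / m)
  else (a / m - 1) ::ₘ (a / m + 1) ::ₘ (Finset.Ico (a + 1 - m) (a - 1)).val.map (· / m)

theorem card_dipMultiset {a : ℕ} (hm : 0 < m) (ha : a ∈ dips m r) :
    Multiset.card (dipMultiset m r a) = m := by
  obtain ⟨⟨h1, h2⟩, h3, -⟩ := mem_dips.1 ha
  have h4 := Nat.mod_lt a hm
  rw [dipMultiset]
  split_ifs
  · simp only [Multiset.card_cons, Multiset.card_map, Finset.card_val, Nat.card_Ico]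
    omega
  · simp only [Multiset.card_cons, Multiset.card_map, Finset.card_val, Nat.card_Ico]
    omega

theorem le_of_mem_dipMultiset {a k : ℕ} (hm : 0 < m) (ha : a ∈ dips m r)
    (hk : k ∈ dipMultiset m r a) : k ≤ r := by
  obtain ⟨⟨h1, h2⟩, h3, -⟩ := mem_dips.1 ha
  have hr : a / m ≤ r := Nat.le_of_lt_succ ((Nat.div_lt_iff_lt_mul hm).2 h2)
  have hmap : ∀ {b c}, c ≤ a → k ∈ (Finset.Ico b c).val.map (· / m) → k ≤ r := by
    intro b c hc hk
    obtain ⟨x, hx, rfl⟩ := Multiset.mem_map.1 hk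
    have := Finset.mem_Ico.1 (Finset.mem_def.2 hx)
    exact (Nat.div_le_div_right (by omega)).trans hr
  rw [dipMultiset] at hk
  split_ifs at hk with h <;> simp only [Multiset.mem_cons] at hk <;>
    rcases hk with rfl | rfl | hk
  · omega
  · omega
  · exact hmap le_rfl hk
  · omega
  · omega
  · exact hmap (by omega) hk

/-- With j = a / m, the corrections are second differences: φ (j - 1) + φ (j + 1) - 2 φ j is the
covered part of bridge j minus that of bridge j + 1, as X cancels. For j < r the window of a + 1
contains j twice because m does not divide a. For j = r the window of a contains j - 1 twice because
a % m + 1 < m, and the index j - 2 exists because r ≥ 2. -/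
theorem dip_eq (h : BridgeWalk n m r X φ) (hr : 2 ≤ r) {a : ℕ} (ha : a ∈ dips m r) :
    ∃ c : ℝ, ∀ u, dip n m r X φ a u = ((dipMultiset m r a).map (φ · u)).sum + c := by
  obtain ⟨⟨h1, h2⟩, h3, h4⟩ := mem_dips.1 ha
  have h5 := Nat.mod_lt a h.pos
  have h6 := Nat.div_add_mod' a m
  have hj : 1 ≤ a / m := (Nat.one_le_div_iff h.pos).2 h1
  have hjr : a / m ≤ r := Nat.le_of_lt_succ ((Nat.div_lt_iff_lt_mul h.pos).2 h2)
  have hmap : ∀ (s : Finset ℕ) (u : ℕ), ((s.val.map (· / m)).map (φ · u)).sum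
      = ∑ b ∈ s, φ (b / m) u := by
    intro s u
    rw [Multiset.map_map]
    rfl
  by_cases hjr' : a / m = r
  · have h7 := h4 hjr'
    have e1 : (a - m) / m = a / m - 1 := by
      have := div_sub_self h.pos h1
      omega
    have e2 : (a - m + 1) / m = a / m - 1 := by
      have h8 : a / m * m = (a / m - 1) * m + m := by
        rw [← Nat.succ_mul, Nat.succ_eq_add_one, Nat.sub_add_cancel hj]
      rw [Nat.div_eq_iff h.pos]
      omega
    refine ⟨shift n m X a
      - (n (a / m - 1) - covered n m (a / m) (2 * a) + n (a / m) / (4 * m)), fun u => ?_⟩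
    have d1 := h.sub_succ (a / m - 2) (by omega) u
    have d2 := h.sub_succ (a / m - 1) (by omega) u
    rw [show a / m - 2 + 1 = a / m - 1 by omega] at d1
    rw [Nat.sub_add_cancel hj] at d2
    have hw : ∑ b ∈ Finset.Ico (a - m) a, φ (b / m) u = φ (a / m - 1) u + (φ (a / m - 1) u
        + ∑ b ∈ Finset.Ico (a - m + 2) a, φ (b / m) u) := by
      rw [Finset.sum_eq_sum_Ico_succ_bot (by omega), Finset.sum_eq_sum_Ico_succ_bot (by omega),
        e1, e2]
    rw [dip, if_pos hjr', dipLeft, dipMultiset, if_pos hjr', mono, window_sum, hw,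
      Multiset.map_cons, Multiset.map_cons, Multiset.sum_cons, Multiset.sum_cons, hmap]
    linarith
  · have e1 : (a - 1) / m = a / m := by
      rw [Nat.div_eq_iff h.pos]
      omega
    refine ⟨shift n m X (a + 1) - (covered n m (a / m) (2 * a) + n (a / m) / (4 * m)),
      fun u => ?_⟩
    have d1 := h.sub_succ (a / m - 1) (by omega) u
    have d2 := h.sub_succ (a / m) (by omega) u
    rw [Nat.sub_add_cancel hj] at d1
    have hw : ∑ b ∈ Finset.Ico (a + 1 - m) (a + 1), φ (b / m) u
        = ∑ b ∈ Finset.Ico (a + 1 - m) (a - 1), φ (b / m) u + φ (a / m) u + φ (a / m) u := by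
      have hs : a + 1 - m ≤ a - 1 := by omega
      have := Finset.sum_Ico_succ_top hs fun b => φ (b / m) u
      rw [Nat.sub_add_cancel (by omega), e1] at this
      rw [Finset.sum_Ico_succ_top (by omega), this]
    rw [dip, if_neg hjr', dipRight, dipMultiset, if_neg hjr', mono, window_sum, hw,
      Multiset.map_cons, Multiset.map_cons, Multiset.sum_cons, Multiset.sum_cons, hmap]
    linarith

end BridgeWalk

namespace ChainLengths

open MetricGraph

variable {g : ℕ} (L : ChainLengths g)

/-! ### The functions on the bridges -/

/-- The value of the function with divisor `endsRep i - canonical` on the bridge `j`, at distance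
`t` from its source. -/
def endsFun (i j : ℕ) (t : ℝ) : ℝ :=
  L.endsValue i j + ((j : ℝ) - 1 - i + if i < j then 1 else 0) * t

theorem endsValue_sub_succ (i j : ℕ) : L.endsValue i j - L.endsValue (i + 1) j =
    ∑ l ∈ Finset.range j, (L.n l + L.m (l + 1)) + if i + 1 < j then L.n (i + 1) else 0 := by
  induction j with
  | zero => simp [endsValue]
  | succ j ih =>
    rw [endsValue, endsValue, Finset.sum_range_succ]
    rcases lt_trichotomy (i + 1) j with h | h | h
    · rw [if_pos h] at ih
      rw [if_pos (by omega), if_pos h, if_pos (by omega)]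
      push_cast
      linarith
    · subst h
      rw [if_neg (lt_irrefl _)] at ih
      rw [if_pos (by omega), if_neg (lt_irrefl _), if_pos (by omega)]
      push_cast
      linarith
    · rw [if_neg h.not_gt] at ih
      rw [if_neg (by omega), if_neg h.not_gt, if_neg (by omega)]
      push_cast
      linarith

/-- The distance from the left end to a point on the bridge `j`, along the bottom edges. -/
def dist (j : ℕ) (t : ℝ) : ℝ := ∑ l ∈ Finset.range j, (L.n l + L.m (l + 1)) + t

theorem endsFun_sub_succ (i j : ℕ) (t : ℝ) : L.endsFun i j t - L.endsFun (i + 1) j t =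
    L.dist j t + if j < i + 1 then 0 else if j = i + 1 then t else L.n (i + 1) := by
  have h := L.endsValue_sub_succ i j
  rw [endsFun, endsFun, dist]
  rcases lt_trichotomy j (i + 1) with h1 | h1 | h1
  · rw [if_neg h1.not_gt] at h
    rw [if_neg (by omega), if_neg h1.not_gt, if_pos h1]
    push_cast
    linarith
  · rw [if_neg h1.not_gt] at h
    rw [if_pos (by omega), if_neg h1.not_gt, if_neg h1.not_lt, if_pos h1]
    push_cast
    linarith
  · rw [if_pos h1] at h
    rw [if_pos (by omega), if_pos h1, if_neg h1.not_gt, if_neg h1.ne']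
    push_cast
    linarith

/-- The distance on the bridge `u / (2 m)` after `u` steps, if each bridge takes `2 m` steps. -/
def stepDist (m u : ℕ) : ℝ := ((u % (2 * m) : ℕ) : ℝ) / (2 * m) * L.n (u / (2 * m))

theorem covered_eq_stepDist {m : ℕ} (hm : 0 < m) (l u : ℕ) : covered L.n m l u =
    if u / (2 * m) < l then 0 else if u / (2 * m) = l then L.stepDist m u else L.n l := by
  have h0 := Nat.div_add_mod u (2 * m)
  have h1 := Nat.mod_lt u (show 0 < 2 * m by omega)
  have hm' : (0 : ℝ) < 2 * m := by positivity
  rcases lt_trichotomy (u / (2 * m)) l with h | h | h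
  · rw [if_pos h, covered_of_le hm]
    have := (Nat.div_lt_iff_lt_mul (show 0 < 2 * m by omega)).1 h
    calc u ≤ l * (2 * m) := this.le
      _ = 2 * (l * m) := by ring
  · rw [if_neg h.not_lt, if_pos h, stepDist, h]
    rw [h] at h0
    have e1 : 2 * m * l = 2 * (l * m) := by ring
    have e2 : 2 * ((l + 1) * m) = 2 * (l * m) + 2 * m := by ring
    rw [covered_eq hm (by omega) (by omega)]
    have h0' : (u : ℝ) = 2 * m * l + ((u % (2 * m) : ℕ) : ℝ) := by exact_mod_cast h0.symm
    rw [h0']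
    field_simp
    ring
  · rw [if_neg h.not_gt, if_neg h.ne', covered_of_ge hm]
    have := (Nat.le_div_iff_mul_le (show 0 < 2 * m by omega)).1 (Nat.succ_le_of_lt h)
    calc 2 * ((l + 1) * m) = (l + 1) * (2 * m) := by ring
      _ ≤ u := this

theorem stepDist_mem {m u : ℕ} (hm : 0 < m) (h : u / (2 * m) ≤ g) :
    L.stepDist m u ∈ Set.Icc 0 (L.n (u / (2 * m))) := by
  have h1 := Nat.mod_lt u (show 0 < 2 * m by omega)
  have hn := (L.n_pos _ h).le
  have hm' : (0 : ℝ) < 2 * m := by positivity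
  have h2 : ((u % (2 * m) : ℕ) : ℝ) ≤ 2 * m := by exact_mod_cast h1.le
  refine ⟨by rw [stepDist]; positivity, mul_le_of_le_one_left hn ?_⟩
  rwa [div_le_one hm']

/-- Equality holds for a step inside a bridge. The step onto the next bridge also crosses the bottom
edge of a loop, which only adds to the distance. -/
theorem le_dist_succ {m u : ℕ} (hm : 0 < m) (h : u / (2 * m) < g) :
    L.n (u / (2 * m)) / (2 * m) ≤ L.dist ((u + 1) / (2 * m)) (L.stepDist m (u + 1))
      - L.dist (u / (2 * m)) (L.stepDist m u) := by
  have h0 := Nat.div_add_mod u (2 * m)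
  have h1 := Nat.mod_lt u (show 0 < 2 * m by omega)
  have hm' : (0 : ℝ) < 2 * m := by positivity
  by_cases hc : u % (2 * m) + 1 < 2 * m
  · have e1 : (u + 1) / (2 * m) = u / (2 * m) := by
      rw [Nat.div_eq_iff (by omega), mul_comm]
      omega
    have e2 : (u + 1) % (2 * m) = u % (2 * m) + 1 := by
      have := Nat.div_add_mod (u + 1) (2 * m)
      rw [e1] at this
      omega
    rw [dist, dist, stepDist, stepDist, e1, e2]
    push_cast
    apply le_of_eq
    ring
  · have e0 : 2 * m * (u / (2 * m) + 1) = 2 * m * (u / (2 * m)) + 2 * m := by ring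
    have e1 : (u + 1) / (2 * m) = u / (2 * m) + 1 := by
      rw [Nat.div_eq_iff (by omega), mul_comm (u / (2 * m) + 1)]
      omega
    have e2 : (u + 1) % (2 * m) = 0 := by
      have := Nat.div_add_mod (u + 1) (2 * m)
      rw [e1] at this
      omega
    have e3 : ((u % (2 * m) : ℕ) : ℝ) + 1 = 2 * m := by
      exact_mod_cast (show u % (2 * m) + 1 = 2 * m by omega)
    have hmu := L.m_pos (u / (2 * m) + 1) (Nat.le_add_left 1 _) h
    rw [dist, dist, stepDist, stepDist, e1, e2, Finset.sum_range_succ,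
      show ((u % (2 * m) : ℕ) : ℝ) = 2 * m - 1 by linarith]
    have e4 : (2 * (m : ℝ) - 1) / (2 * m) = 1 - 1 / (2 * m) := by
      field_simp
    rw [e4]
    have e5 : L.n (u / (2 * m)) / (2 * m) = 1 / (2 * m) * L.n (u / (2 * m)) := by ring
    rw [e5]
    simp only [Nat.cast_zero, zero_div, zero_mul, add_zero]
    linarith

theorem bridgeWalk {r m : ℕ} (L : ChainLengths (r + 1)) (hm : 0 < m) :
    BridgeWalk L.n m r (fun u => L.dist (u / (2 * m)) (L.stepDist m u))
      (fun i u => L.endsFun i (u / (2 * m)) (L.stepDist m u)) where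
  pos := hm
  len_pos l hl := L.n_pos l (by omega)
  covered_le l hl u v huv := by
    induction v, huv using Nat.le_induction with
    | base => simp
    | succ v huv ih =>
      intro hv
      have h1 := ih (by omega)
      have h2 : v / (2 * m) < r + 1 := by
        rw [Nat.div_lt_iff_lt_mul (by omega)]
        calc v < 2 * ((r + 1) * m) := by omega
          _ = (r + 1) * (2 * m) := by ring
      have h3 := L.le_dist_succ hm h2
      have h4 := covered_succ_sub (n := L.n) hm l v
      have h5 := L.n_pos _ h2.le
      have h6 : (0 : ℝ) < L.n (v / (2 * m)) / (2 * m) := by positivity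
      split_ifs at h4 with h
      · rw [h] at h1 h4 ⊢
        linarith
      · linarith
  sub_succ i _ u := by rw [L.endsFun_sub_succ, L.covered_eq_stepDist hm]

end ChainLengths

/-! ### The main theorem -/

theorem exists_sym_map_val {r m : ℕ} {M : Multiset ℕ} (h : Multiset.card M = m)
    (hM : ∀ k ∈ M, k ≤ r) :
    ∃ I : Sym (Fin (r + 1)) m, (I : Multiset (Fin (r + 1))).map Fin.val = M := by
  refine ⟨⟨M.map (Fin.ofNat (r + 1)), by simpa using h⟩, ?_⟩
  change (M.map (Fin.ofNat (r + 1))).map Fin.val = M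
  rw [Multiset.map_map]
  refine (Multiset.map_congr rfl fun k hk => ?_).trans (Multiset.map_id M)
  exact Nat.mod_eq_of_lt (Nat.lt_succ_of_le (hM k hk))

namespace ChainLengths

open MetricGraph

theorem exists_independent {r m : ℕ} (L : ChainLengths (r + 1)) (hr : 2 ≤ r) (hm : 1 ≤ m)
    {ψ : Sym (Fin (r + 1)) m → L.graph.Point → ℝ}
    (hψ : ∀ I, ∀ j : Fin (r + 1 + 1), ∀ t ∈ Set.Icc 0 (L.n j), ψ I (onEdge (L.bridge j) t) =
      ((I : Multiset (Fin (r + 1))).map fun i : Fin (r + 1) => L.endsFun i j t).sum) :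
    ∃ A : Finset (Sym (Fin (r + 1)) m), A.card + r = 2 * m * r ∧ ¬ TropicallyDependent A ψ := by
  have hW := L.bridgeWalk (show 0 < m by omega)
  set X : ℕ → ℝ := fun u => L.dist (u / (2 * m)) (L.stepDist m u)
  set φ : ℕ → ℕ → ℝ := fun i u => L.endsFun i (u / (2 * m)) (L.stepDist m u) with hφ
  set S := (Finset.Icc m ((r + 1) * m)).disjSum (BridgeWalk.dips m r) with hS
  have hmul : 2 * m * r = 2 * (r * m) := by ring
  have hrm : r ≤ r * m := Nat.le_mul_of_pos_right r hm
  have hcard : 2 * (r * m) ≤ S.card + r := by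
    have := BridgeWalk.le_card_dips (show 0 < m by omega) r
    rw [hS, Finset.card_disjSum, Nat.card_Icc, add_mul, one_mul]
    omega
  let M : ℕ ⊕ ℕ → Multiset ℕ := Sum.elim (BridgeWalk.window m) (BridgeWalk.dipMultiset m r)
  have hsym : ∀ α ∈ S, ∃ I : Sym (Fin (r + 1)) m,
      (I : Multiset (Fin (r + 1))).map Fin.val = M α := by
    rintro (E | a) hα
    · have h1 := Finset.mem_Icc.1 (Finset.inl_mem_disjSum.1 hα)
      exact exists_sym_map_val (BridgeWalk.card_window h1.1)
        fun k hk => BridgeWalk.le_of_mem_window hW.pos h1.2 hk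
    · have h1 := Finset.inr_mem_disjSum.1 hα
      exact exists_sym_map_val (BridgeWalk.card_dipMultiset hW.pos h1)
        fun k hk => BridgeWalk.le_of_mem_dipMultiset hW.pos h1 hk
  have hconst : ∀ α ∈ S, ∃ c : ℝ, ∀ u, Sum.elim (BridgeWalk.mono L.n m X φ)
      (BridgeWalk.dip L.n m r X φ) α u = ((M α).map (φ · u)).sum + c := by
    rintro (E | a) hα
    · exact ⟨_, fun u => rfl⟩
    · exact hW.dip_eq hr (Finset.inr_mem_disjSum.1 hα)
  have : Nonempty (Sym (Fin (r + 1)) m) := ⟨Sym.replicate m 0⟩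
  choose! I hI using hsym
  choose! c hc using hconst
  let step : ℕ ⊕ ℕ → ℕ := Sum.elim (fun E => 2 * E - 1) (fun a => 2 * a)
  have hstep : ∀ α ∈ S, step α / (2 * m) < r + 1 := by
    intro α hα
    rw [Nat.div_lt_iff_lt_mul (by omega), show (r + 1) * (2 * m) = 2 * ((r + 1) * m) by ring]
    rcases α with E | a
    · have h1 := Finset.mem_Icc.1 (Finset.inl_mem_disjSum.1 hα)
      change 2 * E - 1 < _
      omega
    · have h1 := (BridgeWalk.mem_dips.1 (Finset.inr_mem_disjSum.1 hα)).1
      change 2 * a < _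
      omega
  let p : ℕ ⊕ ℕ → L.graph.Point := fun α =>
    onEdge (L.bridge (Fin.ofNat (r + 1 + 1) (step α / (2 * m)))) (L.stepDist m (step α))
  have hval : ∀ α ∈ S, ∀ β ∈ S, ψ (I β) (p α) + c β
      = Sum.elim (BridgeWalk.mono L.n m X φ) (BridgeWalk.dip L.n m r X φ) β (step α) := by
    intro α hα β hβ
    have hj : ((Fin.ofNat (r + 1 + 1) (step α / (2 * m)) : Fin (r + 1 + 1)) : ℕ)
        = step α / (2 * m) := Nat.mod_eq_of_lt (by have := hstep α hα; omega)
    have ht := L.stepDist_mem (u := step α) hW.pos (hstep α hα).le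
    rw [hc β hβ, ← hI β hβ, hψ _ _ _ (by rw [hj]; exact ht), hj, Multiset.map_map]
    rfl
  -- A certificate restricts to subfamilies, so functions in excess of the required number are
  -- discarded.
  obtain ⟨S', hS', hS'card⟩ := Finset.exists_subset_card_eq
    (show 2 * (r * m) - r ≤ S.card by omega)
  have hcert : ∀ α ∈ S', ∀ β ∈ S', α ≠ β → ψ (I α) (p α) + c α < ψ (I β) (p α) + c β := by
    intro α hα β hβ hne
    rw [hval α (hS' hα) α (hS' hα), hval α (hS' hα) β (hS' hβ)]
    exact hW.certificate α (hS' hα) β (hS' hβ) hne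
  classical
  refine ⟨S'.image I, ?_, not_tropicallyDependent_image (Finset.card_pos.1 (by omega)) c p hcert⟩
  rw [Finset.card_image_of_injOn (injOn_of_certificate c p hcert), hS'card]
  omega

end ChainLengths

end
/-- The tropical maximal rank conjecture holds for the canonical divisor, in every degree `m`. -/
theorem theorem1p5 (g r d m : ℕ) (hg : 3 ≤ g) (hm : 1 ≤ m) (hr : r = g - 1) (hd : d = 2 * g - 2) :
    TropicalMaximalRank g r d m := by
  obtain rfl : g = r + 1 := by omega
  obtain rfl : d = 2 * r := by omega
  -- The argument works for every positive value of the constant.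
  refine ⟨1, one_pos, fun L hLadm => ?_⟩
  have hL : L.LongTops := fun k => by
    have := hLadm.bottom_lt_top (k + 1) (by omega) (by omega)
    push_cast at this
    exact this
  refine ⟨L.canonical, ?_, ChainLengths.isVertexAvoiding_canonical hL, L.endsRep,
    ChainLengths.isEndsRep_endsRep hL, ?_⟩
  · rw [ChainLengths.deg_canonical]
    push_cast
    ring
  choose ψ hψ hψv using fun I : Sym (Fin (r + 1)) m =>
    ChainLengths.exists_isDiv_multiset hL (I : Multiset (Fin (r + 1)))
  obtain ⟨A, hA, hind⟩ := L.exists_independent (by omega) hm hψv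
  refine ⟨ψ, fun I => by simpa using hψ I, A, ?_, hind⟩
  -- That m d - g + 1 is the smaller of the two numbers need not be computed: it is the size of a
  -- set of multisets.
  have hle : A.card ≤ (r + m).choose m := by
    refine (Finset.card_le_univ A).trans (le_of_eq ?_)
    rw [Sym.card_sym_eq_choose, Fintype.card_fin]
    congr 1
    omega
  have hA' : (A.card : ℤ) = m * (2 * r : ℕ) - (r + 1 : ℕ) + 1 := by
    zify at hA
    push_cast
    linarith
  rw [← hA', min_eq_right]
  exact_mod_cast hle
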